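/- Let $n\ge 1$ and let $\Omega\subset\mathbb R^n$ be a bounded open set with Lipschitz boundary; $\mathbf n$ denotes its outward unit normal and $dS$ the surface measure on $\partial\Omega$. Let $W(x,y,F)$ be an energy density defined and of class $C^1$ on an open set $\mathcal U\subset\mathbb R^n\times\mathbb R^m\times\mathbb R^{m\times n}$, and scale-free: $W(\lambda x,\lambda y,F)=W(x,y,F)$ for all $\lambda>0$ (whenever both points lie in $\mathcal U$). In particular $W=W(F)$ is allowed. Put $$P(x,y,F)=W_F(x,y,F),\qquad P^*(x,y,F)=W(x,y,F)\,I_n-F^TP(x,y,F),$$ $$\mathcal E(F,G)=W(G)-W(F)-\langle W_F(F),G-F\rangle$$ ($\mathcal E$ is the Weierstrass excess function, with the arguments $x,y$ of $W$ held fixed and suppressed; $\langle A,B\rangle=\operatorname{tr}(A^TB)$). Let $y_1,y_2:\overline\Omega\to\mathbb R^m$ be Lipschitz continuous deformations, of class $C^2$ up to the boundary in a neighborhood of $\partial\Omega$, such that for $j=1,2$ the points $(x,y_j(x),\nabla y_j(x))$, for a.e. $x\in\Omega$, lie in a compact subset of $\mathcal U$. Assume that $y_1$ and $y_2$ are stationary,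 i.e. that each $y=y_j$ satisfies, in the sense of distributions in $\Omega$, $$W_y-\nabla\cdot P=0,\qquad W_x-\nabla\cdot P^*=0,$$ with $W_x,W_y,P,P^*$ evaluated at $(x,y(x),\nabla y(x))$, and that they have the same Dirichlet data, $y_1=y_2=y_0$ on $\partial\Omega$. Write $F_j=\nabla y_j(x)$ and $P_j=W_F(x,y_j(x),F_j)$. Then $$\int_\Omega\{W(x,y_2,F_2)-W(x,y_1,F_1)\}\,dx=\frac1n\int_{\partial\Omega}\Big\{\mathcal E(F_1,F_2)\,(x\cdot\mathbf n)+(P_1-P_2)\mathbf n\cdot(F_2x-y_0)\Big\}\,dS(x),$$ where on $\partial\Omega$ the excess $\mathcal E(F_1,F_2)$ is taken at $(x,y_0(x))$. The functions $W(x,y_j,F_j)$ are integrable on $\Omega$ and the boundary integrand is integrable on $\partial\Omega$. -/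

import Mathlib

open MeasureTheory Set Filter Topology
open scoped ContDiff NNReal RealInnerProductSpace

noncomputable section

namespace Elasticity

/-- Euclidean space `ℝⁿ`. -/
abbrev V (n : ℕ) : Type := EuclideanSpace ℝ (Fin n)

/-- Real `m × n` matrices, as linear maps `ℝⁿ → ℝᵐ`. -/
abbrev Mat (m n : ℕ) : Type := V n →L[ℝ] V m

/-- Energy densities `W(x, y, F)` with `x ∈ ℝⁿ`, `y ∈ ℝᵐ`, `F ∈ ℝ^{m×n}`. -/
abbrev Density (n m : ℕ) : Type := V n × V m × Mat m n → ℝ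

/-! ### Matrices -/

/-- The matrix unit `e_i ⊗ e_α`, i.e. the map `v ↦ v_α e_i`. -/
def matUnit {m n : ℕ} (i : Fin m) (α : Fin n) : Mat m n :=
  (EuclideanSpace.proj α : V n →L[ℝ] ℝ).smulRight (EuclideanSpace.single i (1 : ℝ))

/-- The Frobenius product `⟨A, B⟩ = ∑ A_{iα} B_{iα}`. -/
def frob {m n : ℕ} (A B : Mat m n) : ℝ :=
  ∑ i, ∑ α, A (EuclideanSpace.single α 1) i * B (EuclideanSpace.single α 1) i

/-! ### The energy density, its partial derivatives, and the stress tensors -/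

/-- The partial differential `W_x`. -/
def dX {n m : ℕ} (W : Density n m) (p : V n × V m × Mat m n) : V n →L[ℝ] ℝ :=
  fderiv ℝ (fun x => W (x, p.2.1, p.2.2)) p.1

/-- The partial differential `W_y`. -/
def dY {n m : ℕ} (W : Density n m) (p : V n × V m × Mat m n) : V m →L[ℝ] ℝ :=
  fderiv ℝ (fun y => W (p.1, y, p.2.2)) p.2.1

/-- The partial differential of `W` in `F`. -/
def dF {n m : ℕ} (W : Density n m) (p : V n × V m × Mat m n) : Mat m n →L[ℝ] ℝ :=
  fderiv ℝ (fun F => W (p.1, p.2.1, F)) p.2.2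

/-- The Piola stress tensor `P = W_F`, the matrix with the entries `∂W/∂F_{iα}`. -/
def piola {n m : ℕ} (W : Density n m) (p : V n × V m × Mat m n) : Mat m n :=
  ∑ i, ∑ α, dF W p (matUnit i α) • matUnit i α

/-- The Eshelby tensor `P* = W I - Fᵀ P`. -/
def eshelby {n m : ℕ} (W : Density n m) (p : V n × V m × Mat m n) : Mat n n :=
  W p • ContinuousLinearMap.id ℝ (V n)
    - (ContinuousLinearMap.adjoint p.2.2).comp (piola W p)

/-- The Weierstrass excess function `W(G) - W(F) - ⟨W_F(F), G - F⟩`, at fixed `x` and `y`. -/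
def excess {n m : ℕ} (W : Density n m) (x : V n) (y : V m) (F G : Mat m n) : ℝ :=
  W (x, y, G) - W (x, y, F) - frob (piola W (x, y, F)) (G - F)

/-- The density `W`, with domain of definition `𝒰`, is scale-free:
`W(λx, λy, F) = W(x, y, F)` for all `λ > 0`. -/
def IsScaleFree {n m : ℕ} (W : Density n m) (𝒰 : Set (V n × V m × Mat m n)) : Prop :=
  ∀ c : ℝ, 0 < c → ∀ (x : V n) (y : V m) (F : Mat m n),
    (x, y, F) ∈ 𝒰 → (c • x, c • y, F) ∈ 𝒰 → W (c • x, c • y, F) = W (x, y, F)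

/-- The Piola tensor represents the derivative of `W` in `F` in the Frobenius product. -/
theorem frob_piola {n m : ℕ} (W : Density n m) (p : V n × V m × Mat m n) (H : Mat m n) :
    frob (piola W p) H = dF W p H := by
  have hH : H = ∑ i, ∑ α, H (EuclideanSpace.single α 1) i • matUnit i α := by
    apply ContinuousLinearMap.coe_injective
    refine (EuclideanSpace.basisFun (Fin n) ℝ).toBasis.ext fun β => ?_
    ext j
    simp [matUnit, Pi.single_apply]
  conv_rhs => rw [hH]
  simp only [map_sum, map_smul, smul_eq_mul, frob]
  refine Finset.sum_congr rfl fun i _ => Finset.sum_congr rfl fun α _ => ?_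
  rw [mul_comm]
  congr 1
  simp [piola, matUnit, Pi.single_apply]

/-! ### The reference domain, its outward normal -/

/-- `Ω` has Lipschitz boundary: near each boundary point, and in suitable Cartesian coordinates
with vertical axis `e`, `Ω` is the set above the graph of a Lipschitz function on `e^⊥`. -/
def HasLipschitzBoundary {n : ℕ} (Ω : Set (V n)) : Prop :=
  ∀ p ∈ frontier Ω, ∃ (e : V n) (γ : (ℝ ∙ e)ᗮ → ℝ) (K : ℝ≥0) (N : Set (V n)),
    ‖e‖ = 1 ∧ LipschitzWith K γ ∧ IsOpen N ∧ p ∈ N ∧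
    ∀ x ∈ N, x ∈ Ω ↔ γ ((ℝ ∙ e)ᗮ.orthogonalProjectionOnto x) < ⟪x, e⟫

/-- The unit vector `ν` is the outward normal of `Ω` at `x`: the hyperplane `x + ν^⊥` is tangent to
the boundary, i.e. for every `ε > 0` and all `z` near `x`, `z` lies in `Ω` if
`(z - x) · ν < - ε |z - x|` and lies outside if `(z - x) · ν > ε |z - x|`. -/
def IsOuterUnitNormal {n : ℕ} (Ω : Set (V n)) (x ν : V n) : Prop :=
  ‖ν‖ = 1 ∧ ∀ ε : ℝ, 0 < ε → ∀ᶠ z in 𝓝 x,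
    (⟪z - x, ν⟫ < -(ε * ‖z - x‖) → z ∈ Ω) ∧ (ε * ‖z - x‖ < ⟪z - x, ν⟫ → z ∉ Ω)

theorem IsOuterUnitNormal.unique {n : ℕ} {Ω : Set (V n)} {x ν ν' : V n}
    (h : IsOuterUnitNormal Ω x ν) (h' : IsOuterUnitNormal Ω x ν') : ν = ν' := by
  by_contra hne
  have hd : 0 < ‖ν' - ν‖ := norm_pos_iff.2 (sub_ne_zero.2 (Ne.symm hne))
  have hsq : ‖ν' - ν‖ ^ 2 = 2 - 2 * ⟪ν', ν⟫ := by
    rw [norm_sub_sq_real, h.1, h'.1]; ring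
  have e1 : ⟪ν' - ν, ν⟫ = -(‖ν' - ν‖ ^ 2 / 2) := by
    rw [inner_sub_left, real_inner_self_eq_norm_sq, h.1, hsq]; ring
  have e2 : ⟪ν' - ν, ν'⟫ = ‖ν' - ν‖ ^ 2 / 2 := by
    rw [inner_sub_left, real_inner_self_eq_norm_sq, h'.1, hsq, real_inner_comm]; ring
  have hε : 0 < ‖ν' - ν‖ / 4 := by positivity
  have ht : Tendsto (fun t : ℝ => x + t • (ν' - ν)) (𝓝[>] 0) (𝓝 x) := by
    have : Continuous fun t : ℝ => x + t • (ν' - ν) := by fun_prop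
    have h0 := this.tendsto 0
    simp only [zero_smul, add_zero] at h0
    exact h0.mono_left nhdsWithin_le_nhds
  obtain ⟨t, ⟨⟨ha, hb⟩, htpos⟩⟩ := (((ht.eventually (h.2 _ hε)).and
    (ht.eventually (h'.2 _ hε))).and self_mem_nhdsWithin).exists
  have htpos' : 0 < t := htpos
  have hpos : 0 < t * ‖ν' - ν‖ ^ 2 := by positivity
  simp only [add_sub_cancel_left, inner_smul_left, norm_smul, Real.norm_eq_abs,
    abs_of_pos htpos', RCLike.conj_to_real, e1, e2] at ha hb
  exact hb.2 (by nlinarith) (ha.1 (by nlinarith))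

open Classical in
/-- The outward unit normal `n(x)`; it exists at almost every point of a Lipschitz boundary
(and is set to `0` where there is none). -/
def outerNormal {n : ℕ} (Ω : Set (V n)) (x : V n) : V n :=
  if h : ∃ ν, IsOuterUnitNormal Ω x ν then h.choose else 0

theorem IsOuterUnitNormal.outerNormal_eq {n : ℕ} {Ω : Set (V n)} {x ν : V n}
    (h : IsOuterUnitNormal Ω x ν) : outerNormal Ω x = ν := by
  have hex : ∃ ν, IsOuterUnitNormal Ω x ν := ⟨ν, h⟩
  rw [outerNormal, dif_pos hex]
  exact hex.choose_spec.unique h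

/-! ### Deformations -/

/-- The deformation gradient `F = ∇y` of `y : closure Ω → ℝᵐ`. At the points of the open set `Ω` it
is the ordinary derivative; on the boundary it is the one-sided derivative, from `closure Ω`. -/
def defGrad {n m : ℕ} (Ω : Set (V n)) (y : V n → V m) (x : V n) : Mat m n :=
  fderivWithin ℝ y (closure Ω) x

theorem defGrad_eq_fderiv {n m : ℕ} {Ω : Set (V n)} (hΩ : IsOpen Ω) (y : V n → V m) {x : V n}
    (hx : x ∈ Ω) : defGrad Ω y x = fderiv ℝ y x :=
  fderivWithin_of_mem_nhds (mem_of_superset (hΩ.mem_nhds hx) subset_closure)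

/-- The point `(x, y(x), ∇y(x))`, at which `W` and its derivatives are evaluated. -/
def jet {n m : ℕ} (Ω : Set (V n)) (y : V n → V m) (x : V n) : V n × V m × Mat m n :=
  (x, y x, defGrad Ω y x)

/-- The configuration `y` is Lipschitz continuous on `closure Ω`. -/
def IsLipschitzConfig {n m : ℕ} (Ω : Set (V n)) (y : V n → V m) : Prop :=
  ∃ K : ℝ≥0, LipschitzOnWith K y (closure Ω)

/-- `y` is of class `C²`, up to the boundary, in a neighborhood of `∂Ω`. -/
def IsC2NearBoundary {n m : ℕ} (Ω : Set (V n)) (y : V n → V m) : Prop :=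
  ∃ N : Set (V n), IsOpen N ∧ frontier Ω ⊆ N ∧ ContDiffOn ℝ 2 y (closure Ω ∩ N)

/-- The range of `(x, y(x), ∇y(x))` stays in a compact part of the domain `𝒰` of `W`. -/
def HasRangeIn {n m : ℕ} (Ω : Set (V n)) (y : V n → V m) (𝒰 : Set (V n × V m × Mat m n)) : Prop :=
  ∃ K : Set (V n × V m × Mat m n), IsCompact K ∧ K ⊆ 𝒰 ∧
    ∀ᵐ x ∂(volume.restrict Ω), jet Ω y x ∈ K

/-- Test fields `φ ∈ C_0^∞(Ω; ℝᵏ)`. -/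
def IsTestField {n k : ℕ} (Ω : Set (V n)) (φ : V n → V k) : Prop :=
  ContDiff ℝ ∞ φ ∧ HasCompactSupport φ ∧ tsupport φ ⊆ Ω

/-- `y` is an extremal: `W_y - ∇ · P = 0` in the sense of distributions. -/
def IsExtremal {n m : ℕ} (W : Density n m) (Ω : Set (V n)) (y : V n → V m) : Prop :=
  ∀ φ : V n → V m, IsTestField Ω φ →
    ∫ x in Ω, (dY W (jet Ω y x) (φ x) + frob (piola W (jet Ω y x)) (fderiv ℝ φ x)) = 0

/-- `y` is stationary: it is an extremal, and `W_x - ∇ · P* = 0` in the sense of distributions. -/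
def IsStationary {n m : ℕ} (W : Density n m) (Ω : Set (V n)) (y : V n → V m) : Prop :=
  IsExtremal W Ω y ∧
  ∀ φ : V n → V n, IsTestField Ω φ →
    ∫ x in Ω, (dX W (jet Ω y x) (φ x) + frob (eshelby W (jet Ω y x)) (fderiv ℝ φ x)) = 0

/-- The surface measure `dS` in `ℝⁿ`: the `(n-1)`-dimensional Hausdorff measure, normalized so that
it is Lebesgue measure on hyperplanes. -/
def surfaceMeasure (n : ℕ) : Measure (V n) := Measure.euclideanHausdorffMeasure (n - 1)

/-- The integrand `𝓔(F₁, F₂) (x · n) + (P₁ - P₂) n · (F₂ x - y₀)` of the boundary integral. -/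
def boundaryDensity {n m : ℕ} (W : Density n m) (Ω : Set (V n)) (y₁ y₂ y₀ : V n → V m)
    (x : V n) : ℝ :=
  excess W x (y₀ x) (defGrad Ω y₁ x) (defGrad Ω y₂ x) * ⟪x, outerNormal Ω x⟫
    + ⟪(piola W (jet Ω y₁ x) - piola W (jet Ω y₂ x)) (outerNormal Ω x),
        defGrad Ω y₂ x x - y₀ x⟫

end Elasticity

end

/-! Everything rests on one vector field. Testing the equation for `P*` against multiples of the
position field `x`, and the equation for `P` against multiples of `y`, and adding, gives for the
field `P*ᵀ x + Pᵀ y` (`scalingField`) the divergence `⟨P*, I⟩ + ⟨P, F⟩ + W_x · x + W_y · y`. The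
first two terms add up to `n W`, because the contributions of `Fᵀ P` cancel (`frob_eshelby_id`); the
last two cancel by Euler's identity for functions homogeneous of degree zero (`IsScaleFree.euler`).
The divergence theorem thus turns `n ∫ W` into a flux through `∂Ω` (`IsStationary.energy_eq_flux`),
a Clapeyron type formula.

Subtracting the formulas for `y₁` and `y₂` leaves a difference of fluxes. As `y₂ - y₁` vanishes on
`∂Ω`, its tangential derivatives vanish there, so `F₂ - F₁` has rank one in the normal direction
(`HasLipschitzBoundary.ae_rank_one`). With this the difference of fluxes is pointwise the excess
expression (`flux_sub_flux_eq_boundaryDensity`).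

The analytic work lies in the divergence theorem for a Lipschitz boundary, Hausdorff surface
measure, and a field that is continuous near `∂Ω` but merely integrable with a distributional
divergence inside (`HasLipschitzBoundary.integral_div_eq_flux`). It needs the area formula for
Lipschitz graphs, the passage from smooth to Lipschitz test functions by mollification, and a cutoff
at vertical height `c` over the boundary graph: the gradient of the cutoff concentrates on a thin
layer and yields the flux as `c → 0`. -/

noncomputable section

set_option linter.unusedSectionVars false

namespace Elasticity

/-! ### Hausdorff measure of Lipschitz graphs -/

section Graph

open scoped ENNReal

variable {E : Type*} [NormedAddCommGroup E] [InnerProductSpace ℝ E] [FiniteDimensional ℝ E]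
  [MeasurableSpace E] [BorelSpace E] {e : E}

/-- The parametrization `x ↦ x + γ(x) e` of the graph of `γ`. -/
def graphMap (e : E) (γ : (ℝ ∙ e)ᗮ → ℝ) (x : (ℝ ∙ e)ᗮ) : E := x + γ x • e

/-- The linear parametrization `v ↦ v + ℓ(v) e` of the graph of a linear form. -/
def graphLin (e : E) (ℓ : (ℝ ∙ e)ᗮ →L[ℝ] ℝ) : (ℝ ∙ e)ᗮ →L[ℝ] E :=
  (ℝ ∙ e)ᗮ.subtypeL + ℓ.smulRight e

theorem graphLin_apply (ℓ : (ℝ ∙ e)ᗮ →L[ℝ] ℝ) (v : (ℝ ∙ e)ᗮ) :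
    graphLin e ℓ v = v + ℓ v • e := rfl

/-- The area factor `√(1 + |ℓ|²)` of the graph of a linear form. -/
def areaFactor {F : Type*} [NormedAddCommGroup F] [NormedSpace ℝ F] (ℓ : F →L[ℝ] ℝ) : ℝ :=
  √(1 + ‖ℓ‖ ^ 2)

theorem inner_coe_orthogonal (v : (ℝ ∙ e)ᗮ) : ⟪(v : E), e⟫ = 0 := by
  have := Submodule.mem_orthogonal_singleton_iff_inner_left.1 v.2
  exact this

theorem norm_sq_add_smul (he : ‖e‖ = 1) (v : (ℝ ∙ e)ᗮ) (t : ℝ) :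
    ‖(v : E) + t • e‖ ^ 2 = ‖v‖ ^ 2 + t ^ 2 := by
  rw [norm_add_sq_real, inner_smul_right, inner_coe_orthogonal, norm_smul, he]
  simp

theorem one_le_areaFactor {F : Type*} [NormedAddCommGroup F] [NormedSpace ℝ F] (ℓ : F →L[ℝ] ℝ) :
    1 ≤ areaFactor ℓ := by
  rw [areaFactor, Real.one_le_sqrt]
  nlinarith [sq_nonneg ‖ℓ‖]

theorem areaFactor_le_add {F : Type*} [NormedAddCommGroup F] [NormedSpace ℝ F]
    (ℓ ℓ' : F →L[ℝ] ℝ) : areaFactor ℓ ≤ areaFactor ℓ' + ‖ℓ - ℓ'‖ := by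
  have h1 : ‖ℓ‖ ≤ ‖ℓ'‖ + ‖ℓ - ℓ'‖ := by
    calc ‖ℓ‖ = ‖ℓ' + (ℓ - ℓ')‖ := by congr 1; abel
      _ ≤ _ := norm_add_le _ _
  have h2 : ‖ℓ'‖ ≤ areaFactor ℓ' := Real.le_sqrt_of_sq_le (by linarith)
  have h3 : areaFactor ℓ' ^ 2 = 1 + ‖ℓ'‖ ^ 2 := Real.sq_sqrt (by positivity)
  have h4 := one_le_areaFactor ℓ'
  refine Real.sqrt_le_iff.2 ⟨by positivity, ?_⟩
  have h5 : ‖ℓ‖ ^ 2 ≤ (‖ℓ'‖ + ‖ℓ - ℓ'‖) ^ 2 := by gcongr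
  have h6 : ‖ℓ'‖ * ‖ℓ - ℓ'‖ ≤ areaFactor ℓ' * ‖ℓ - ℓ'‖ := by gcongr
  nlinarith

/-- A rank one perturbation `B` of the identity on `e^⊥` has `|B v| = |graphLin v|` and determinant
equal to the area factor. Then `graphLin ∘ B⁻¹` is an isometry, and only the determinant of `B`
affects the measure. -/
theorem euclideanHausdorffMeasure_image_graphLin (he : ‖e‖ = 1) (ℓ : (ℝ ∙ e)ᗮ →L[ℝ] ℝ)
    (s : Set (ℝ ∙ e)ᗮ) :
    Measure.euclideanHausdorffMeasure (Module.finrank ℝ (ℝ ∙ e)ᗮ) (graphLin e ℓ '' s) =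
      ENNReal.ofReal (areaFactor ℓ) * volume s := by
  let H := (ℝ ∙ e)ᗮ
  set a : H := (InnerProductSpace.toDual ℝ H).symm ℓ with ha
  have hℓ (v : H) : ℓ v = ⟪a, v⟫ := by simp [ha]
  have hna : ‖ℓ‖ = ‖a‖ := by simp [ha]
  set J := areaFactor ℓ with hJ
  have hJ1 : 1 ≤ J := one_le_areaFactor ℓ
  have hJ2 : J ^ 2 = 1 + ‖a‖ ^ 2 := by rw [hJ, areaFactor, Real.sq_sqrt (by positivity), hna]
  -- This `c` meets both requirements on `B v = v + c ℓ(v) a`: determinant `1 + c |a|² = J`, and `2c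
  -- + c² |a|² = 1`, which makes `|B v|² = |v|² + ℓ(v)²`.
  set c : ℝ := 1 / (J + 1) with hc
  have hc1 : c * ‖a‖ ^ 2 = J - 1 := by
    rw [hc]; field_simp; nlinarith
  have hc2 : c * (J + 1) = 1 := by rw [hc]; field_simp
  set B : H →ₗ[ℝ] H := LinearMap.transvection (ℓ : H →ₗ[ℝ] ℝ) (c • a) with hB
  have hdet : LinearMap.det B = J := by
    rw [hB, LinearMap.transvection.det]
    simp only [ContinuousLinearMap.coe_coe, hℓ, inner_smul_right, real_inner_self_eq_norm_sq]
    linarith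
  have hBn (v : H) : ‖B v‖ ^ 2 = ‖graphLin e ℓ v‖ ^ 2 := by
    rw [graphLin_apply, norm_sq_add_smul he]
    have : B v = v + ℓ v • (c • a) := rfl
    rw [this, norm_add_sq_real, inner_smul_right, inner_smul_right, real_inner_comm, ← hℓ,
      norm_smul, norm_smul, mul_pow, mul_pow]
    simp only [Real.norm_eq_abs, sq_abs]
    have : c * 2 + c ^ 2 * ‖a‖ ^ 2 = 1 := by
      rw [sq, mul_assoc, hc1]; linarith
    linear_combination (ℓ v) ^ 2 * this
  have hBu : IsUnit (LinearMap.det B) := by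
    rw [hdet]; exact isUnit_iff_ne_zero.2 (by linarith)
  set Be : H ≃ₗ[ℝ] H := LinearEquiv.ofIsUnitDet (v := Module.finBasis ℝ H)
    (v' := Module.finBasis ℝ H) (f := B) (by simpa [LinearMap.det_toMatrix] using hBu)
  have hBe (v : H) : Be v = B v := rfl
  set f : H →ₗ[ℝ] E := (graphLin e ℓ : H →ₗ[ℝ] E) ∘ₗ (Be.symm : H →ₗ[ℝ] H)
  have hf : Isometry f := by
    refine AddMonoidHomClass.isometry_of_norm f fun v => ?_
    have h1 := hBn (Be.symm v)
    rw [← hBe, Be.apply_symm_apply] at h1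
    exact ((sq_eq_sq₀ (norm_nonneg _) (norm_nonneg _)).1 h1).symm
  have himg : graphLin e ℓ '' s = f '' (B '' s) := by
    rw [image_image]
    refine image_congr fun v _ => ?_
    simp [f, ← hBe]
  rw [himg, hf.euclideanHausdorffMeasure_image,
    InnerProductSpace.euclideanHausdorffMeasure_eq_volume, Measure.addHaar_image_linearMap,
    hdet, abs_of_nonneg (by linarith)]

/-- The hypothesis makes `f ∘ g⁻¹` well defined and `C`-Lipschitz on `g '' s`. Two parametrizations
appear so that a graph can be compared with its linearization, in either direction, and with its
parameter domain. -/
theorem euclideanHausdorffMeasure_image_le_of_dist_le {α X Y : Type*} [MetricSpace X]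
    [MeasurableSpace X] [BorelSpace X] [MetricSpace Y] [MeasurableSpace Y] [BorelSpace Y]
    {f : α → Y} {g : α → X} {s : Set α} {C : ℝ≥0} (k : ℕ)
    (h : ∀ x ∈ s, ∀ y ∈ s, dist (f x) (f y) ≤ C * dist (g x) (g y)) :
    Measure.euclideanHausdorffMeasure k (f '' s)
      ≤ (C : ℝ≥0∞) ^ k * Measure.euclideanHausdorffMeasure k (g '' s) := by
  rcases s.eq_empty_or_nonempty with rfl | ⟨x₀, hx₀⟩
  · simp
  have : Nonempty α := ⟨x₀⟩
  have hinv (x : α) (hx : x ∈ s) : f (Function.invFunOn g s (g x)) = f x := by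
    have h1 := Function.invFunOn_mem (f := g) ⟨x, hx, rfl⟩
    have h2 := Function.invFunOn_eq (f := g) ⟨x, hx, rfl⟩
    refine dist_le_zero.1 ((h _ h1 _ hx).trans ?_)
    rw [h2]; simp
  have himg : f '' s = (f ∘ Function.invFunOn g s) '' (g '' s) := by
    rw [image_image]
    exact image_congr fun x hx => (hinv x hx).symm
  have hlip : LipschitzOnWith C (f ∘ Function.invFunOn g s) (g '' s) := by
    refine LipschitzOnWith.of_dist_le_mul ?_
    rintro _ ⟨x, hx, rfl⟩ _ ⟨y, hy, rfl⟩
    simp only [Function.comp_apply, hinv x hx, hinv y hy]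
    exact h x hx y hy
  have := hlip.hausdorffMeasure_image_le (d := k) (by positivity)
  rw [himg, Measure.euclideanHausdorffMeasure_def, Measure.euclideanHausdorffMeasure_def,
    Measure.smul_apply, Measure.smul_apply]
  rw [ENNReal.rpow_natCast] at this
  rw [ENNReal.smul_def, ENNReal.smul_def, smul_eq_mul, smul_eq_mul, mul_left_comm]
  gcongr

theorem norm_le_graphLin (he : ‖e‖ = 1) (ℓ : (ℝ ∙ e)ᗮ →L[ℝ] ℝ) (v : (ℝ ∙ e)ᗮ) :
    ‖v‖ ≤ ‖graphLin e ℓ v‖ := by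
  refine (sq_le_sq₀ (norm_nonneg _) (norm_nonneg _)).1 ?_
  rw [graphLin_apply, norm_sq_add_smul he]
  nlinarith [sq_nonneg (ℓ v)]

/-- The two graphs differ only in the vertical direction, by the linearization error of `γ`, and a
horizontal displacement is no longer than the corresponding one on the linear graph. -/
theorem norm_graphMap_sub_sub_le (he : ‖e‖ = 1) {γ : (ℝ ∙ e)ᗮ → ℝ} {ℓ : (ℝ ∙ e)ᗮ →L[ℝ] ℝ}
    {s : Set (ℝ ∙ e)ᗮ} {δ : ℝ≥0} (h : ApproximatesLinearOn γ ℓ s δ) {x y : (ℝ ∙ e)ᗮ}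
    (hx : x ∈ s) (hy : y ∈ s) :
    ‖graphMap e γ x - graphMap e γ y - (graphLin e ℓ x - graphLin e ℓ y)‖
      ≤ δ * ‖graphLin e ℓ x - graphLin e ℓ y‖ := by
  have h1 : graphMap e γ x - graphMap e γ y - (graphLin e ℓ x - graphLin e ℓ y)
      = (γ x - γ y - ℓ (x - y)) • e := by
    simp only [graphMap, graphLin_apply, map_sub]; module
  rw [h1, norm_smul, he, mul_one, ← map_sub]
  refine (h x hx y hy).trans ?_
  gcongr
  exact norm_le_graphLin he ℓ _

theorem dist_graphMap_le (he : ‖e‖ = 1) {γ : (ℝ ∙ e)ᗮ → ℝ} {ℓ : (ℝ ∙ e)ᗮ →L[ℝ] ℝ}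
    {s : Set (ℝ ∙ e)ᗮ} {δ : ℝ≥0} (h : ApproximatesLinearOn γ ℓ s δ) {x y : (ℝ ∙ e)ᗮ}
    (hx : x ∈ s) (hy : y ∈ s) :
    dist (graphMap e γ x) (graphMap e γ y)
      ≤ (1 + δ : ℝ≥0) * dist (graphLin e ℓ x) (graphLin e ℓ y) := by
  have h1 := norm_graphMap_sub_sub_le he h hx hy
  rw [dist_eq_norm, dist_eq_norm, NNReal.coe_add, NNReal.coe_one]
  have h2 := norm_sub_norm_le (graphMap e γ x - graphMap e γ y)
    (graphLin e ℓ x - graphLin e ℓ y)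
  linarith

theorem dist_graphLin_le (he : ‖e‖ = 1) {γ : (ℝ ∙ e)ᗮ → ℝ} {ℓ : (ℝ ∙ e)ᗮ →L[ℝ] ℝ}
    {s : Set (ℝ ∙ e)ᗮ} {δ : ℝ≥0} (hδ : δ < 1) (h : ApproximatesLinearOn γ ℓ s δ)
    {x y : (ℝ ∙ e)ᗮ} (hx : x ∈ s) (hy : y ∈ s) :
    dist (graphLin e ℓ x) (graphLin e ℓ y)
      ≤ ((1 - δ)⁻¹ : ℝ≥0) * dist (graphMap e γ x) (graphMap e γ y) := by
  have h1 := norm_graphMap_sub_sub_le he h hx hy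
  have hδ' : (δ : ℝ) < 1 := by exact_mod_cast hδ
  rw [dist_eq_norm, dist_eq_norm, NNReal.coe_inv, NNReal.coe_sub hδ.le, NNReal.coe_one,
    inv_mul_eq_div, le_div_iff₀ (by linarith)]
  have h2 := norm_sub_norm_le (graphLin e ℓ x - graphLin e ℓ y)
    (graphMap e γ x - graphMap e γ y)
  rw [norm_sub_rev (graphLin e ℓ x - graphLin e ℓ y)] at h2
  linarith

theorem continuous_graphMap {γ : (ℝ ∙ e)ᗮ → ℝ} (hγ : Continuous γ) :
    Continuous (graphMap e γ) := by
  unfold graphMap; fun_prop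

theorem orthogonalProjectionOnto_add_smul (v : (ℝ ∙ e)ᗮ) (t : ℝ) :
    (ℝ ∙ e)ᗮ.orthogonalProjectionOnto ((v : E) + t • e) = v := by
  rw [map_add, map_smul, Submodule.orthogonalProjectionOnto_mem_subspace_eq_self,
    Submodule.orthogonalProjectionOnto_orthogonal_apply_eq_zero
      (Submodule.mem_span_singleton_self e)]
  simp

theorem measurableEmbedding_graphMap {γ : (ℝ ∙ e)ᗮ → ℝ} (hγ : Continuous γ) :
    MeasurableEmbedding (graphMap e γ) := by
  refine (continuous_graphMap hγ).measurableEmbedding fun x y h => ?_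
  have := congrArg (ℝ ∙ e)ᗮ.orthogonalProjectionOnto h
  simpa [graphMap, orthogonalProjectionOnto_add_smul] using this

/-- Countable additivity over disjointed pieces globalizes a local comparison of measures with a
uniform constant; what the pieces miss only has to be null for the smaller measure. -/
theorem measure_le_const_mul_of_iUnion {α ι : Type*} [Countable ι] [MeasurableSpace α]
    {μ ν : Measure α} {C : ℝ≥0∞} {t : ι → Set α} (ht : ∀ i, MeasurableSet (t i))
    (hcov : μ (⋃ i, t i)ᶜ = 0)
    (h : ∀ i, ∀ u, MeasurableSet u → u ⊆ t i → μ u ≤ C * ν u) (s : Set α)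
    (hs : MeasurableSet s) : μ s ≤ C * ν s := by
  rcases isEmpty_or_nonempty ι with hι | hι
  · simp only [iUnion_of_empty, compl_empty] at hcov
    simp [measure_mono_null (subset_univ s) hcov]
  obtain ⟨φ, hφ⟩ := exists_surjective_nat ι
  set d := disjointed fun n => t (φ n)
  have hd (n) : MeasurableSet (d n) := MeasurableSet.disjointed (fun n => ht _) n
  have hU : ⋃ n, d n = ⋃ i, t i := by
    rw [iUnion_disjointed]; exact hφ.iUnion_comp t
  have hsplit : s ⊆ (⋃ n, s ∩ d n) ∪ (⋃ i, t i)ᶜ := by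
    rw [← inter_iUnion, hU]
    intro x hx
    by_cases hx' : x ∈ ⋃ i, t i
    · exact Or.inl ⟨hx, hx'⟩
    · exact Or.inr hx'
  calc μ s ≤ μ (⋃ n, s ∩ d n) + 0 := by
        rw [← hcov]; exact (measure_mono hsplit).trans (measure_union_le _ _)
    _ = ∑' n, μ (s ∩ d n) := by
        rw [add_zero, measure_iUnion]
        · exact fun i j hij => ((disjoint_disjointed _) hij).mono inter_subset_right
            inter_subset_right
        · exact fun n => hs.inter (hd n)
    _ ≤ ∑' n, C * ν (s ∩ d n) := by
        refine ENNReal.tsum_le_tsum fun n => h (φ n) _ (hs.inter (hd n)) ?_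
        exact inter_subset_right.trans (disjointed_subset _ _)
    _ = C * ν (⋃ n, s ∩ d n) := by
        rw [ENNReal.tsum_mul_left, measure_iUnion]
        · exact fun i j hij => ((disjoint_disjointed _) hij).mono inter_subset_right
            inter_subset_right
        · exact fun n => hs.inter (hd n)
    _ ≤ C * ν s := by
        gcongr
        exact iUnion_subset fun n => inter_subset_left

/-- On a set where `γ` is differentiable with derivative oscillating by at most `δ`, the area of
the graph and the integral of the area factor agree up to a factor close to `1`. -/
theorem graph_measure_compare (he : ‖e‖ = 1) {γ : (ℝ ∙ e)ᗮ → ℝ} {s : Set (ℝ ∙ e)ᗮ}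
    (hs : MeasurableSet s) {ℓ : (ℝ ∙ e)ᗮ →L[ℝ] ℝ} {δ : ℝ≥0} (hδ : δ < 1)
    (h : ApproximatesLinearOn γ ℓ s δ) (hosc : ∀ x ∈ s, ‖fderiv ℝ γ x - ℓ‖ ≤ δ) :
    Measure.euclideanHausdorffMeasure (Module.finrank ℝ (ℝ ∙ e)ᗮ) (graphMap e γ '' s)
        ≤ ((1 + δ : ℝ≥0) : ℝ≥0∞) ^ (Module.finrank ℝ (ℝ ∙ e)ᗮ + 1)
          * ∫⁻ x in s, ENNReal.ofReal (areaFactor (fderiv ℝ γ x)) ∧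
    ∫⁻ x in s, ENNReal.ofReal (areaFactor (fderiv ℝ γ x)) ≤
      ((1 + δ : ℝ≥0) * ((1 - δ)⁻¹ : ℝ≥0) ^ (Module.finrank ℝ (ℝ ∙ e)ᗮ) : ℝ≥0) *
      Measure.euclideanHausdorffMeasure (Module.finrank ℝ (ℝ ∙ e)ᗮ) (graphMap e γ '' s) := by
  set k := Module.finrank ℝ (ℝ ∙ e)ᗮ
  -- The area factor is 1-Lipschitz in the slope and at least `1`, so an additive error `δ` is also
  -- a relative error `δ`.
  have key (ℓ₁ ℓ₂ : (ℝ ∙ e)ᗮ →L[ℝ] ℝ) (h12 : ‖ℓ₁ - ℓ₂‖ ≤ δ) :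
      ENNReal.ofReal (areaFactor ℓ₁) ≤ (1 + δ : ℝ≥0) * ENNReal.ofReal (areaFactor ℓ₂) := by
    rw [← ENNReal.ofReal_coe_nnreal, ← ENNReal.ofReal_mul (by positivity)]
    refine ENNReal.ofReal_le_ofReal ?_
    have h1 := areaFactor_le_add ℓ₁ ℓ₂
    have h2 := one_le_areaFactor ℓ₂
    push_cast
    nlinarith [δ.2]
  have hconst : ENNReal.ofReal (areaFactor ℓ) * volume s
      = ∫⁻ x in s, ENNReal.ofReal (areaFactor ℓ) := by simp
  have hlin := euclideanHausdorffMeasure_image_graphLin he ℓ s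
  constructor
  · calc _ ≤ ((1 + δ : ℝ≥0) : ℝ≥0∞) ^ k * (ENNReal.ofReal (areaFactor ℓ) * volume s) := by
          rw [← hlin]
          exact euclideanHausdorffMeasure_image_le_of_dist_le k
            fun x hx y hy => dist_graphMap_le he h hx hy
      _ ≤ ((1 + δ : ℝ≥0) : ℝ≥0∞) ^ k *
          ∫⁻ x in s, (1 + δ : ℝ≥0) * ENNReal.ofReal (areaFactor (fderiv ℝ γ x)) := by
          rw [hconst]
          gcongr 1
          refine setLIntegral_mono' hs fun x hx => key _ _ ?_
          exact (norm_sub_rev ℓ (fderiv ℝ γ x)).trans_le (hosc x hx)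
      _ = _ := by
          rw [lintegral_const_mul' _ _ ENNReal.coe_ne_top, pow_succ, mul_assoc]
  · calc _ ≤ ∫⁻ x in s, (1 + δ : ℝ≥0) * ENNReal.ofReal (areaFactor ℓ) :=
          setLIntegral_mono' hs fun x hx => key _ _ (hosc x hx)
      _ = (1 + δ : ℝ≥0) *
          Measure.euclideanHausdorffMeasure k (graphLin e ℓ '' s) := by
          rw [lintegral_const_mul' _ _ ENNReal.coe_ne_top, ← hconst, hlin]
      _ ≤ _ := by
          rw [ENNReal.coe_mul, mul_assoc]
          gcongr
          rw [ENNReal.coe_pow]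
          exact euclideanHausdorffMeasure_image_le_of_dist_le k
            fun x hx y hy => dist_graphLin_le he hδ h hx hy

theorem measurable_areaFactor_fderiv (γ : (ℝ ∙ e)ᗮ → ℝ) :
    Measurable fun x => areaFactor (fderiv ℝ γ x) := by
  have := measurable_fderiv ℝ γ
  unfold areaFactor
  fun_prop

/-- The **area formula** for Lipschitz graphs. -/
theorem euclideanHausdorffMeasure_restrict_range_graphMap (he : ‖e‖ = 1) {γ : (ℝ ∙ e)ᗮ → ℝ}
    {K : ℝ≥0} (hγ : LipschitzWith K γ) :
    (Measure.euclideanHausdorffMeasure (Module.finrank ℝ (ℝ ∙ e)ᗮ) :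
        Measure E).restrict (range (graphMap e γ)) =
      (volume.withDensity fun x => ENNReal.ofReal (areaFactor (fderiv ℝ γ x))).map
        (graphMap e γ) := by
  set k := Module.finrank ℝ (ℝ ∙ e)ᗮ
  have hemb := measurableEmbedding_graphMap (e := e) hγ.continuous
  set μ : Measure (ℝ ∙ e)ᗮ := (Measure.euclideanHausdorffMeasure k).comap (graphMap e γ) with hμ
  set ν : Measure (ℝ ∙ e)ᗮ :=
    volume.withDensity fun x => ENNReal.ofReal (areaFactor (fderiv ℝ γ x)) with hν
  have hμs (s : Set (ℝ ∙ e)ᗮ) :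
      μ s = Measure.euclideanHausdorffMeasure k (graphMap e γ '' s) := hemb.comap_apply _ s
  have hνs (s : Set (ℝ ∙ e)ᗮ) (hs : MeasurableSet s) :
      ν s = ∫⁻ x in s, ENNReal.ofReal (areaFactor (fderiv ℝ γ x)) := withDensity_apply _ hs
  suffices hμν : μ = ν by rw [← hμν, hμ, hemb.map_comap]
  -- The graph map is `(1 + K)`-Lipschitz. This disposes of the null set where `γ` is not
  -- differentiable.
  have hac (s : Set (ℝ ∙ e)ᗮ) (hs : volume s = 0) : μ s = 0 := by
    rw [hμs]
    have hcmp := euclideanHausdorffMeasure_image_le_of_dist_le (f := graphMap e γ) (g := id)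
      (s := s) (C := 1 + K) k fun x _ y _ => by
        have h1 : graphMap e γ x - graphMap e γ y = ((x - y : (ℝ ∙ e)ᗮ) : E) +
            (γ x - γ y) • e := by
          simp only [graphMap, Submodule.coe_sub]; module
        have h2 := hγ.dist_le_mul x y
        rw [Real.dist_eq] at h2
        rw [dist_eq_norm, h1]
        refine (norm_add_le _ _).trans ?_
        rw [norm_smul, he, mul_one, Real.norm_eq_abs, NNReal.coe_add, NNReal.coe_one, add_mul,
          one_mul]
        simp only [id]
        gcongr
        rw [dist_eq_norm]; rfl
    rw [image_id, InnerProductSpace.euclideanHausdorffMeasure_eq_volume, hs, mul_zero] at hcmp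
    exact nonpos_iff_eq_zero.1 hcmp
  set D : Set (ℝ ∙ e)ᗮ := {x | DifferentiableAt ℝ γ x}
  have hDm : MeasurableSet D := measurableSet_of_differentiableAt ℝ γ
  have hDc : volume Dᶜ = 0 := hγ.ae_differentiableAt
  have hcover (δ : ℝ≥0) (hδ : 0 < δ) : ∃ (t : ℕ × ℕ → Set (ℝ ∙ e)ᗮ)
      (A : ℕ × ℕ → (ℝ ∙ e)ᗮ →L[ℝ] ℝ), (∀ i, MeasurableSet (t i)) ∧ (⋃ i, t i) = D ∧
      (∀ i, ApproximatesLinearOn γ (A i) (t i) δ) ∧ ∀ i, ∀ x ∈ t i, ‖fderiv ℝ γ x - A i‖ ≤ δ := by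
    -- Sorting points by a slope `q n` within `δ / 2` of the derivative forces any two derivatives
    -- in one class to be `δ`-close. The linear map chosen on a piece is a derivative at some point
    -- of the same class, so both approximation properties hold with `δ`.
    set q := TopologicalSpace.denseSeq ((ℝ ∙ e)ᗮ →L[ℝ] ℝ)
    set S : ℕ → Set (ℝ ∙ e)ᗮ := fun n => D ∩ {x | ‖fderiv ℝ γ x - q n‖ < δ / 2}
    have hS (n) : MeasurableSet (S n) :=
      hDm.inter (measurableSet_lt (((measurable_fderiv ℝ γ).sub_const _).norm) measurable_const)
    have hpart (n) := exists_partition_approximatesLinearOn_of_hasFDerivWithinAt γ (S n)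
      (fderiv ℝ γ) (fun x hx => (DifferentiableAt.hasFDerivAt hx.1).hasFDerivWithinAt)
      (fun _ => δ) (fun _ => hδ.ne')
    choose t A _ htm htc happ hex using hpart
    refine ⟨fun i => S i.1 ∩ t i.1 i.2, fun i => A i.1 i.2, fun i => (hS _).inter (htm _ _), ?_,
      fun i => happ _ _, fun i x hx => ?_⟩
    · refine subset_antisymm (iUnion_subset fun i => inter_subset_left.trans inter_subset_left) ?_
      intro x hx
      obtain ⟨n, hn⟩ := (TopologicalSpace.denseRange_denseSeq _).exists_dist_lt
        (fderiv ℝ γ x) (show (0 : ℝ) < δ / 2 by positivity)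
      replace hn := (dist_eq_norm (fderiv ℝ γ x) (q n)).symm.trans_lt hn
      obtain ⟨m, hm⟩ := mem_iUnion.1 (htc n (show x ∈ S n from ⟨hx, hn⟩))
      exact mem_iUnion.2 ⟨(n, m), ⟨hx, hn⟩, hm⟩
    · obtain ⟨y, hy, hAy⟩ := hex i.1 ⟨x, hx.1⟩ i.2
      have h1 := hx.1.2
      have h2 := hy.2
      simp only [mem_ofPred_eq] at h1 h2
      simp only [hAy]
      calc ‖fderiv ℝ γ x - fderiv ℝ γ y‖
          = ‖(fderiv ℝ γ x - q i.1) - (fderiv ℝ γ y - q i.1)‖ := by congr 1; abel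
        _ ≤ ‖fderiv ℝ γ x - q i.1‖ + ‖fderiv ℝ γ y - q i.1‖ :=
          norm_sub_le (fderiv ℝ γ x - q i.1) (fderiv ℝ γ y - q i.1)
        _ ≤ δ := by linarith
  have hle1 (δ : ℝ≥0) (hδ : 0 < δ) (hδ1 : δ < 1) (s) (hs : MeasurableSet s) :
      μ s ≤ (((1 + δ) ^ (k + 1) : ℝ≥0) : ℝ≥0∞) * ν s := by
    obtain ⟨t, A, htm, htc, happ, hosc⟩ := hcover δ hδ
    refine measure_le_const_mul_of_iUnion htm (by rw [htc]; exact hac _ hDc) ?_ s hs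
    intro i u hu hui
    rw [hμs, hνs u hu, ENNReal.coe_pow]
    exact (graph_measure_compare he hu hδ1 ((happ i).mono_set hui)
      fun x hx => hosc i x (hui hx)).1
  have hle2 (δ : ℝ≥0) (hδ : 0 < δ) (hδ1 : δ < 1) (s) (hs : MeasurableSet s) :
      ν s ≤ (((1 + δ) * ((1 - δ)⁻¹) ^ k : ℝ≥0) : ℝ≥0∞) * μ s := by
    obtain ⟨t, A, htm, htc, happ, hosc⟩ := hcover δ hδ
    refine measure_le_const_mul_of_iUnion htm ?_ ?_ s hs
    · rw [htc]
      exact withDensity_absolutelyContinuous _ _ hDc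
    intro i u hu hui
    rw [hμs, hνs u hu]
    exact (graph_measure_compare he hu hδ1 ((happ i).mono_set hui)
      fun x hx => hosc i x (hui hx)).2
  -- The constants in the two comparisons tend to `1` as `δ → 0`, so both become exact inequalities.
  have hlim (c : ℝ≥0 → ℝ≥0) (hc : ContinuousAt c 0) (hc0 : c 0 = 1) {a b : ℝ≥0∞}
      (h : ∀ δ : ℝ≥0, 0 < δ → δ < 1 → a ≤ c δ * b) : a ≤ b := by
    have ht : Tendsto (fun δ : ℝ≥0 => (c δ : ℝ≥0∞) * b) (𝓝[>] 0) (𝓝 (1 * b)) := by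
      refine ENNReal.Tendsto.mul_const ?_ (Or.inl one_ne_zero)
      have := (ENNReal.tendsto_coe.2 hc.tendsto).mono_left (nhdsWithin_le_nhds (s := Ioi 0))
      rwa [hc0] at this
    rw [one_mul] at ht
    refine ge_of_tendsto ht ?_
    filter_upwards [Ioo_mem_nhdsGT (zero_lt_one' ℝ≥0)] with δ hδ using h δ hδ.1 hδ.2
  refine Measure.ext fun s hs => le_antisymm ?_ ?_
  · exact hlim (fun δ => (1 + δ) ^ (k + 1)) (by fun_prop) (by simp)
      fun δ h0 h1 => hle1 δ h0 h1 s hs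
  · refine hlim (fun δ => (1 + δ) * ((1 - δ)⁻¹) ^ k) ?_ (by simp)
      fun δ h0 h1 => hle2 δ h0 h1 s hs
    refine (continuousAt_const.add continuousAt_id).mul (ContinuousAt.pow ?_ _)
    refine ContinuousAt.inv₀ ?_ (by simp)
    exact (continuous_const.sub continuous_id).continuousAt

end Graph

/-! ### Lipschitz test fields -/

section Mollify

open ContinuousLinearMap Convolution

variable {E F : Type*} [NormedAddCommGroup E] [InnerProductSpace ℝ E] [FiniteDimensional ℝ E]
  [MeasurableSpace E] [BorelSpace E] [NormedAddCommGroup F] [NormedSpace ℝ F]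
  [FiniteDimensional ℝ F]

theorem norm_normed_convolution_le (b : ContDiffBump (0 : E)) {G : Type*} [NormedAddCommGroup G]
    [NormedSpace ℝ G] {f : E → G} {C : ℝ} (hC : ∀ x, ‖f x‖ ≤ C) (x : E) :
    ‖(b.normed volume ⋆[lsmul ℝ ℝ, volume] f) x‖ ≤ C := by
  rw [convolution_def]
  calc _ ≤ ∫ t, b.normed volume t * C := by
        refine norm_integral_le_of_norm_le (b.integrable_normed.mul_const C)
          (Eventually.of_forall fun t => ?_)
        rw [lsmul_apply, norm_smul, Real.norm_of_nonneg (b.nonneg_normed t)]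
        exact mul_le_mul_of_nonneg_left (hC _) (b.nonneg_normed t)
    _ = C := by rw [integral_mul_const, b.integral_normed, one_mul]

/-- Differentiation under the integral, with the derivative placed on `f`: Rademacher's theorem
provides it for almost every translate, and the Lipschitz constant dominates the difference
quotients. The gradient of a mollification is then the mollification of a bounded gradient, so it
stays bounded by `K` and converges almost everywhere. -/
theorem hasFDerivAt_normed_convolution (b : ContDiffBump (0 : E)) {f : E → F} {K : ℝ≥0}
    (hf : LipschitzWith K f) (x : E) :
    HasFDerivAt (b.normed volume ⋆[lsmul ℝ ℝ, volume] f)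
      ((b.normed volume ⋆[lsmul ℝ ℝ, volume] (fderiv ℝ f)) x) x := by
  have hcont (z : E) : Continuous fun t => b.normed volume t • f (z - t) :=
    b.continuous_normed.smul (hf.continuous.comp (by fun_prop))
  have hdiff : ∀ᵐ t : E, DifferentiableAt ℝ f (x - t) := by
    have hq : Measure.QuasiMeasurePreserving (fun t : E => x - t) volume volume :=
      (Measure.measurePreserving_sub_left volume x).quasiMeasurePreserving
    exact hq.ae hf.ae_differentiableAt
  refine (hasFDerivAt_integral_of_dominated_loc_of_lip' (μ := volume) (s := univ)
    (F := fun z t => b.normed volume t • f (z - t))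
    (F' := fun t => b.normed volume t • fderiv ℝ f (x - t))
    (bound := fun t => b.normed volume t * K) univ_mem
    (fun z _ => (hcont z).aestronglyMeasurable) ?_ ?_ ?_ (b.integrable_normed.mul_const _) ?_).2
  · exact (hcont x).integrable_of_hasCompactSupport b.hasCompactSupport_normed.smul_right
  · exact (b.continuous_normed.measurable.smul
      ((measurable_fderiv ℝ f).comp (by fun_prop))).aestronglyMeasurable
  · refine Eventually.of_forall fun t z _ => ?_
    rw [← smul_sub, norm_smul, Real.norm_of_nonneg (b.nonneg_normed t), mul_assoc]
    refine mul_le_mul_of_nonneg_left ?_ (b.nonneg_normed t)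
    simpa [dist_eq_norm] using hf.dist_le_mul (z - t) (x - t)
  · filter_upwards [hdiff] with t ht
    have h1 : HasFDerivAt (fun z => f (z - t)) (fderiv ℝ f (x - t)) x := by
      have h2 := ht.hasFDerivAt.comp x (hasFDerivAt_sub_const t)
      rwa [ContinuousLinearMap.comp_id] at h2
    exact h1.const_smul _

theorem continuous_frob {n k : ℕ} : Continuous fun p : Mat k n × Mat k n => frob p.1 p.2 := by
  unfold frob; fun_prop

theorem abs_frob_le {n k : ℕ} (A B : Mat k n) : |frob A B| ≤ (k * n) * (‖A‖ * ‖B‖) := by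
  have h (A : Mat k n) (i α) : |A (EuclideanSpace.single α 1) i| ≤ ‖A‖ :=
    calc _ ≤ ‖A (EuclideanSpace.single α 1)‖ := PiLp.norm_apply_le _ i
      _ ≤ ‖A‖ * ‖(EuclideanSpace.single α 1 : V n)‖ := A.le_opNorm _
      _ = ‖A‖ := by simp
  calc |frob A B| ≤ ∑ _i : Fin k, ∑ _α : Fin n, ‖A‖ * ‖B‖ := by
        refine (Finset.abs_sum_le_sum_abs _ _).trans (Finset.sum_le_sum fun i _ => ?_)
        refine (Finset.abs_sum_le_sum_abs _ _).trans (Finset.sum_le_sum fun α _ => ?_)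
        rw [abs_mul]
        exact mul_le_mul (h A i α) (h B i α) (abs_nonneg _) (norm_nonneg _)
    _ = _ := by simp [mul_assoc]

theorem aestronglyMeasurable_weak_integrand {α : Type*} [MeasurableSpace α] {μ : Measure α}
    {n k : ℕ} {L : α → V k →L[ℝ] ℝ} {M : α → Mat k n} {u : α → V k} {U : α → Mat k n}
    (hL : AEStronglyMeasurable L μ) (hM : AEStronglyMeasurable M μ)
    (hu : AEStronglyMeasurable u μ) (hU : AEStronglyMeasurable U μ) :
    AEStronglyMeasurable (fun x => L x (u x) + frob (M x) (U x)) μ := by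
  have h1 : Continuous fun p : (V k →L[ℝ] ℝ) × V k => p.1 p.2 := by fun_prop
  have h2 := hL.prodMk hu
  have h3 := hM.prodMk hU
  have h4 := h1.comp_aestronglyMeasurable h2
  have h5 := continuous_frob.comp_aestronglyMeasurable h3
  exact h4.add h5

theorem continuous_frob_right {n k : ℕ} (A : Mat k n) : Continuous fun B => frob A B := by
  unfold frob; fun_prop

/-- A weak equation which holds for all smooth test fields holds for Lipschitz test fields. -/
theorem weak_equation_of_lipschitz {n k : ℕ} {Ω : Set (V n)} (hΩ : IsOpen Ω)
    {L : V n → V k →L[ℝ] ℝ} {M : V n → Mat k n}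
    (hL : IntegrableOn L Ω) (hM : IntegrableOn M Ω)
    (h : ∀ φ : V n → V k, IsTestField Ω φ →
      ∫ x in Ω, (L x (φ x) + frob (M x) (fderiv ℝ φ x)) = 0)
    {φ : V n → V k} {K : ℝ≥0} (hφ : LipschitzWith K φ) (hc : HasCompactSupport φ)
    (hs : tsupport φ ⊆ Ω) :
    ∫ x in Ω, (L x (φ x) + frob (M x) (fderiv ℝ φ x)) = 0 := by
  obtain ⟨r, hr, hrΩ⟩ := hc.isCompact.exists_cthickening_subset_open hΩ hs
  obtain ⟨C, hC⟩ := hc.exists_bound_of_continuous hφ.continuous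
  -- Outer radii at most `r` keep the supports of the mollifications inside `Ω`; the fixed ratio `2`
  -- of the radii is what convergence at Lebesgue points requires.
  set b : ℕ → ContDiffBump (0 : V n) := fun i =>
    ⟨r / 2 / (i + 1), r / (i + 1), by positivity, by gcongr; linarith⟩
  have hbr : Tendsto (fun i => (b i).rOut) atTop (𝓝 0) := by
    have := (tendsto_one_div_add_atTop_nhds_zero_nat (𝕜 := ℝ)).const_mul r
    simpa [b, div_eq_mul_inv] using this
  set u : ℕ → V n → V k := fun i => (b i).normed volume ⋆[lsmul ℝ ℝ, volume] φ with hu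
  have hud (i) : ContDiff ℝ ∞ (u i) :=
    (b i).hasCompactSupport_normed.contDiff_convolution_left _ (b i).contDiff_normed
      hφ.continuous.locallyIntegrable
  have huc (i) : HasCompactSupport (u i) := (b i).hasCompactSupport_normed.convolution _ hc
  have hus (i) : tsupport (u i) ⊆ Ω := by
    refine Subset.trans ?_ hrΩ
    refine closure_minimal ?_ Metric.isClosed_cthickening
    refine (support_convolution_subset _).trans ?_
    rw [(b i).support_normed_eq]
    rintro _ ⟨a, ha, c, hc, rfl⟩
    refine Metric.mem_cthickening_of_dist_le _ c _ _ (subset_tsupport _ hc) ?_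
    rw [dist_eq_norm, add_sub_cancel_right]
    rw [Metric.mem_ball, dist_zero_right] at ha
    refine ha.le.trans ?_
    simp only [b]
    exact div_le_self hr.le (by linarith [Nat.cast_nonneg (α := ℝ) i])
  have hfd (i x) : fderiv ℝ (u i) x = ((b i).normed volume ⋆[lsmul ℝ ℝ, volume] (fderiv ℝ φ)) x :=
    (hasFDerivAt_normed_convolution (b i) hφ x).fderiv
  have hzero (i) := h (u i) ⟨hud i, huc i, hus i⟩
  have hbound (i x) : ‖fderiv ℝ (u i) x‖ ≤ K := by
    rw [hfd]
    exact norm_normed_convolution_le _ (fun y => norm_fderiv_le_of_lipschitz ℝ hφ) x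
  have hlim : Tendsto (fun i => ∫ x in Ω, (L x (u i x) + frob (M x) (fderiv ℝ (u i) x))) atTop
      (𝓝 (∫ x in Ω, (L x (φ x) + frob (M x) (fderiv ℝ φ x)))) := by
    refine tendsto_integral_of_dominated_convergence (fun x => ‖L x‖ * C + (k * n) * (‖M x‖ * K)) ?_ ?_ ?_ ?_
    · exact fun i => aestronglyMeasurable_weak_integrand hL.1 hM.1
        (hud i).continuous.aestronglyMeasurable
        ((hud i).continuous_fderiv (by simp)).aestronglyMeasurable
    · exact (hL.norm.mul_const _).add ((hM.norm.mul_const _).const_mul _)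
    · intro i
      refine Eventually.of_forall fun x => (norm_add_le _ _).trans (add_le_add ?_ ?_)
      · refine (le_opNorm _ _).trans ?_
        gcongr
        exact norm_normed_convolution_le _ hC x
      · refine (abs_frob_le _ _).trans ?_
        gcongr
        exact hbound i x
    · have hli : LocallyIntegrable (fderiv ℝ φ) (volume : Measure (V n)) := by
        refine (memLp_top_of_bound (measurable_fderiv ℝ φ).aestronglyMeasurable K
          (Eventually.of_forall fun y => norm_fderiv_le_of_lipschitz ℝ hφ)).locallyIntegrable le_top
      have hae := ContDiffBump.ae_convolution_tendsto_right_of_locallyIntegrable (μ := volume)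
        (K := 2) hbr (Eventually.of_forall fun i => by
          simp only [b]; apply le_of_eq; ring) hli
      filter_upwards [ae_restrict_of_ae hae] with x hx
      have h1 : Tendsto (fun i => u i x) atTop (𝓝 (φ x)) :=
        ContDiffBump.convolution_tendsto_right_of_continuous hbr hφ.continuous x
      have h2 : Tendsto (fun i => fderiv ℝ (u i) x) atTop (𝓝 (fderiv ℝ φ x)) := by
        simpa only [hfd] using hx
      have h3 := ((L x).continuous.tendsto (φ x)).comp h1
      have h4 := ((continuous_frob_right (M x)).tendsto (fderiv ℝ φ x)).comp h2
      exact h3.add h4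
  simp only [hzero] at hlim
  exact (tendsto_nhds_unique hlim tendsto_const_nhds)

end Mollify

/-! ### Graph coordinates -/

section Coordinates

open scoped ENNReal

variable {E : Type*} [NormedAddCommGroup E] [InnerProductSpace ℝ E] [FiniteDimensional ℝ E]
  [MeasurableSpace E] [BorelSpace E] {e : E}

theorem inner_coe_add_smul (he : ‖e‖ = 1) (v : (ℝ ∙ e)ᗮ) (t : ℝ) : ⟪(v : E) + t • e, e⟫ = t := by
  rw [inner_add_left, inner_coe_orthogonal, inner_smul_left, real_inner_self_eq_norm_sq, he]
  simp

theorem orthogonalProjectionOnto_add_inner_smul (he : ‖e‖ = 1) (x : E) :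
    ((ℝ ∙ e)ᗮ.orthogonalProjectionOnto x : E) + ⟪x, e⟫ • e = x := by
  have h := Submodule.starProjection_add_starProjection_orthogonal (K := ℝ ∙ e) x
  rw [Submodule.starProjection_unit_singleton ℝ he, real_inner_comm] at h
  rw [add_comm]
  exact h

/-- The height of `x` above the graph of `γ`. -/
def height (e : E) (γ : (ℝ ∙ e)ᗮ → ℝ) (x : E) : ℝ :=
  ⟪x, e⟫ - γ ((ℝ ∙ e)ᗮ.orthogonalProjectionOnto x)

theorem orthogonalProjectionOnto_graphMap_add (γ : (ℝ ∙ e)ᗮ → ℝ) (v : (ℝ ∙ e)ᗮ) (s : ℝ) :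
    (ℝ ∙ e)ᗮ.orthogonalProjectionOnto (graphMap e γ v + s • e) = v := by
  rw [graphMap, add_assoc, ← add_smul, orthogonalProjectionOnto_add_smul]

theorem height_graphMap_add (he : ‖e‖ = 1) (γ : (ℝ ∙ e)ᗮ → ℝ) (v : (ℝ ∙ e)ᗮ) (s : ℝ) :
    height e γ (graphMap e γ v + s • e) = s := by
  rw [height, orthogonalProjectionOnto_graphMap_add, graphMap, add_assoc, ← add_smul,
    inner_coe_add_smul he]
  ring

theorem graphMap_add_height (he : ‖e‖ = 1) (γ : (ℝ ∙ e)ᗮ → ℝ) (x : E) :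
    graphMap e γ ((ℝ ∙ e)ᗮ.orthogonalProjectionOnto x) + height e γ x • e = x := by
  rw [graphMap, add_assoc, ← add_smul, height, add_sub_cancel,
    orthogonalProjectionOnto_add_inner_smul he]

theorem mem_range_graphMap_iff (he : ‖e‖ = 1) (γ : (ℝ ∙ e)ᗮ → ℝ) (x : E) :
    x ∈ range (graphMap e γ) ↔ height e γ x = 0 := by
  constructor
  · rintro ⟨v, rfl⟩
    simpa using height_graphMap_add he γ v 0
  · intro h
    refine ⟨(ℝ ∙ e)ᗮ.orthogonalProjectionOnto x, ?_⟩
    have := graphMap_add_height he γ x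
    rwa [h, zero_smul, add_zero] at this

theorem lipschitzWith_height (he : ‖e‖ = 1) {γ : (ℝ ∙ e)ᗮ → ℝ} {K : ℝ≥0}
    (hγ : LipschitzWith K γ) : LipschitzWith (1 + K) (height e γ) := by
  refine LipschitzWith.of_dist_le_mul fun x y => ?_
  have h1 : height e γ x - height e γ y = ⟪x - y, e⟫ -
      (γ ((ℝ ∙ e)ᗮ.orthogonalProjectionOnto x) - γ ((ℝ ∙ e)ᗮ.orthogonalProjectionOnto y)) := by
    rw [height, height, inner_sub_left]; ring
  have h2 : |⟪x - y, e⟫| ≤ ‖x - y‖ := by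
    simpa [he] using abs_real_inner_le_norm (x - y) e
  have h3 := (hγ.comp (Submodule.lipschitzWith_orthogonalProjectionOnto (ℝ ∙ e)ᗮ)).dist_le_mul x y
  simp only [Function.comp_apply, mul_one, dist_eq_norm] at h3
  rw [Real.dist_eq, h1, dist_eq_norm, NNReal.coe_add, NNReal.coe_one, add_mul, one_mul]
  exact (abs_sub _ _).trans (add_le_add h2 h3)

/-- Shear coordinates `(v, s) ↦ v + (γ(v) + c s) e`. -/
def shearMap (e : E) (γ : (ℝ ∙ e)ᗮ → ℝ) (c : ℝ) (p : (ℝ ∙ e)ᗮ × ℝ) : E :=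
  graphMap e γ p.1 + (c * p.2) • e

theorem continuous_shearMap {γ : (ℝ ∙ e)ᗮ → ℝ} (hγ : Continuous γ) (c : ℝ) :
    Continuous (shearMap e γ c) := by
  have := continuous_graphMap (e := e) hγ
  unfold shearMap; fun_prop

/-- Translating each vertical line by `γ(v)` preserves product measure by Fubini, without any
differentiability of `γ`; the rest is the orthogonal splitting of the space. -/
theorem measurePreserving_shearMap_one (he : ‖e‖ = 1) {γ : (ℝ ∙ e)ᗮ → ℝ} (hγ : Continuous γ) :
    MeasurePreserving (shearMap e γ 1) (volume.prod volume) volume := by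
  have h1 : MeasurePreserving (fun p : (ℝ ∙ e)ᗮ × ℝ => (p.1, γ p.1 + p.2))
      (volume.prod volume) (volume.prod volume) := by
    refine (MeasurePreserving.id volume).skew_product
      (g := fun v t => γ v + t) (by fun_prop) ?_
    exact Eventually.of_forall fun v => map_add_left_eq_self volume (γ v)
  have h2 : MeasurePreserving (Prod.swap : (ℝ ∙ e)ᗮ × ℝ → ℝ × (ℝ ∙ e)ᗮ)
      (volume.prod volume) (volume.prod volume) := Measure.measurePreserving_swap
  have h3 : MeasurePreserving
      (Prod.map (LinearIsometryEquiv.toSpanUnitSingleton (𝕜 := ℝ) e he) id :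
        ℝ × (ℝ ∙ e)ᗮ → (ℝ ∙ e) × (ℝ ∙ e)ᗮ) (volume.prod volume) (volume.prod volume) :=
    (LinearIsometryEquiv.measurePreserving _).prod (MeasurePreserving.id volume)
  have h4 := ((ℝ ∙ e).measurePreserving_measurableEquivProd (P := E) 0).symm
  rw [InnerProductSpace.euclideanHausdorffMeasure_eq_volume] at h4
  have h5 := h4.comp (h3.comp (h2.comp h1))
  have h6 : shearMap e γ 1 = ((ℝ ∙ e).measurableEquivProd (0 : E)).symm ∘
      Prod.map (LinearIsometryEquiv.toSpanUnitSingleton (𝕜 := ℝ) e he) id ∘ Prod.swap ∘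
      fun p => (p.1, γ p.1 + p.2) := by
    funext p
    simp [shearMap, graphMap, add_smul]
    abel
  rw [h6]
  exact h5

theorem map_shearMap (he : ‖e‖ = 1) {γ : (ℝ ∙ e)ᗮ → ℝ} (hγ : Continuous γ) {c : ℝ} (hc : 0 < c) :
    (volume.prod volume).map (shearMap e γ c) = ENNReal.ofReal c⁻¹ • (volume : Measure E) := by
  have h1 : shearMap e γ c = shearMap e γ 1 ∘ Prod.map id (c * ·) := by
    ext p; simp [shearMap]
  rw [h1, ← Measure.map_map (continuous_shearMap hγ 1).measurable (by fun_prop),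
    ← Measure.map_prod_map _ _ measurable_id (by fun_prop), Measure.map_id,
    Real.map_volume_mul_left hc.ne', Measure.prod_smul_right, Measure.map_smul,
    (measurePreserving_shearMap_one he hγ).map_eq, abs_of_pos (inv_pos.2 hc)]

theorem quasiMeasurePreserving_shearMap (he : ‖e‖ = 1) {γ : (ℝ ∙ e)ᗮ → ℝ} (hγ : Continuous γ)
    {c : ℝ} (hc : 0 < c) :
    Measure.QuasiMeasurePreserving (shearMap e γ c) (volume.prod volume) volume := by
  refine ⟨(continuous_shearMap hγ c).measurable, ?_⟩
  rw [map_shearMap he hγ hc]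
  exact Measure.smul_absolutelyContinuous

theorem integral_shearMap (he : ‖e‖ = 1) {γ : (ℝ ∙ e)ᗮ → ℝ} (hγ : Continuous γ) {c : ℝ}
    (hc : 0 < c) {f : E → ℝ} (hf : AEStronglyMeasurable f) :
    ∫ p, c * f (shearMap e γ c p) ∂(volume.prod volume) = ∫ x, f x := by
  have hf' : AEStronglyMeasurable f ((volume.prod volume).map (shearMap e γ c)) := by
    rw [map_shearMap he hγ hc]; exact hf.smul_measure _
  rw [integral_const_mul,
    ← integral_map (continuous_shearMap hγ c).measurable.aemeasurable hf', map_shearMap he hγ hc,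
    integral_smul_measure, ENNReal.toReal_ofReal (by positivity), smul_eq_mul,
    mul_inv_cancel_left₀ hc.ne']

/-- The gradient of the linear form `ℓ`, as a vector of the ambient space. -/
def ambientGrad (e : E) (ℓ : (ℝ ∙ e)ᗮ →L[ℝ] ℝ) : E :=
  ((InnerProductSpace.toDual ℝ (ℝ ∙ e)ᗮ).symm ℓ : (ℝ ∙ e)ᗮ)

theorem inner_ambientGrad (ℓ : (ℝ ∙ e)ᗮ →L[ℝ] ℝ) (w : E) :
    ⟪w, ambientGrad e ℓ⟫ = ℓ ((ℝ ∙ e)ᗮ.orthogonalProjectionOnto w) := by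
  rw [ambientGrad, real_inner_comm, ← Submodule.inner_orthogonalProjectionOnto_eq_of_mem_left,
    InnerProductSpace.toDual_symm_apply]

/-- The downward unit normal of the graph of `γ` above `v`. -/
def graphNormal (e : E) (γ : (ℝ ∙ e)ᗮ → ℝ) (v : (ℝ ∙ e)ᗮ) : E :=
  (areaFactor (fderiv ℝ γ v))⁻¹ • (ambientGrad e (fderiv ℝ γ v) - e)

/-- The area factor of the surface measure cancels the normalization of the normal. What remains is
minus the derivative of `height` along `w`, which links the boundary layer to the flux. -/
theorem areaFactor_mul_inner_graphNormal (γ : (ℝ ∙ e)ᗮ → ℝ) (v : (ℝ ∙ e)ᗮ) (w : E) :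
    areaFactor (fderiv ℝ γ v) * ⟪w, graphNormal e γ v⟫ =
      fderiv ℝ γ v ((ℝ ∙ e)ᗮ.orthogonalProjectionOnto w) - ⟪w, e⟫ := by
  have := one_le_areaFactor (fderiv ℝ γ v)
  rw [graphNormal, inner_smul_right, mul_inv_cancel_left₀ (by linarith), inner_sub_right,
    inner_ambientGrad]

theorem norm_graphNormal (he : ‖e‖ = 1) (γ : (ℝ ∙ e)ᗮ → ℝ) (v : (ℝ ∙ e)ᗮ) :
    ‖graphNormal e γ v‖ = 1 := by
  set ℓ := fderiv ℝ γ v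
  have h1 : ‖ambientGrad e ℓ - e‖ ^ 2 = areaFactor ℓ ^ 2 := by
    have h := norm_sq_add_smul he ((InnerProductSpace.toDual ℝ (ℝ ∙ e)ᗮ).symm ℓ) (-1)
    rw [neg_smul, one_smul, ← sub_eq_add_neg, LinearIsometryEquiv.norm_map] at h
    rw [areaFactor, Real.sq_sqrt (by positivity), ambientGrad, h]
    ring
  have h2 := one_le_areaFactor ℓ
  have h3 : ‖ambientGrad e ℓ - e‖ = areaFactor ℓ :=
    (sq_eq_sq₀ (norm_nonneg _) (by linarith)).1 h1
  rw [graphNormal, norm_smul, h3, norm_inv, Real.norm_of_nonneg (by linarith),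
    inv_mul_cancel₀ (by linarith)]

theorem measurable_graphNormal (γ : (ℝ ∙ e)ᗮ → ℝ) : Measurable (graphNormal e γ) := by
  have h1 : Continuous (ambientGrad e) :=
    continuous_subtype_val.comp (InnerProductSpace.toDual ℝ (ℝ ∙ e)ᗮ).symm.continuous
  have h2 := h1.measurable.comp (measurable_fderiv ℝ γ)
  exact (measurable_areaFactor_fderiv γ).inv.smul (h2.sub_const e)

end Coordinates

/-! ### Local structure of Lipschitz domains -/

section Local

open scoped ENNReal

variable {n : ℕ}

/-- In the open set `N`, the set `Ω` is the region above the graph of the Lipschitz function `γ`. -/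
structure IsLocalEpigraph (Ω N : Set (V n)) (e : V n) (γ : (ℝ ∙ e)ᗮ → ℝ) (K : ℝ≥0) : Prop where
  norm_eq : ‖e‖ = 1
  lip : LipschitzWith K γ
  isOpen : IsOpen N
  mem_iff : ∀ x ∈ N, x ∈ Ω ↔ 0 < height e γ x

theorem HasLipschitzBoundary.exists_isLocalEpigraph {Ω : Set (V n)} (h : HasLipschitzBoundary Ω)
    {p : V n} (hp : p ∈ frontier Ω) :
    ∃ (e : V n) (γ : (ℝ ∙ e)ᗮ → ℝ) (K : ℝ≥0) (N : Set (V n)),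
      p ∈ N ∧ IsLocalEpigraph Ω N e γ K := by
  obtain ⟨e, γ, K, N, he, hγ, hN, hpN, hiff⟩ := h p hp
  exact ⟨e, γ, K, N, hpN, he, hγ, hN, fun x hx => (hiff x hx).trans sub_pos.symm⟩

namespace IsLocalEpigraph

variable {Ω N : Set (V n)} {e : V n} {γ : (ℝ ∙ e)ᗮ → ℝ} {K : ℝ≥0}

theorem mono (h : IsLocalEpigraph Ω N e γ K) {N' : Set (V n)} (hN' : IsOpen N') (hsub : N' ⊆ N) :
    IsLocalEpigraph Ω N' e γ K :=
  ⟨h.norm_eq, h.lip, hN', fun x hx => h.mem_iff x (hsub hx)⟩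

theorem continuous_height (h : IsLocalEpigraph Ω N e γ K) : Continuous (height e γ) :=
  (lipschitzWith_height h.norm_eq h.lip).continuous

/-- Points of negative height have a neighborhood disjoint from `Ω`, while moving a point of
nonnegative height slightly along `e` brings it into `Ω`. -/
theorem mem_closure_iff (h : IsLocalEpigraph Ω N e γ K) {x : V n} (hx : x ∈ N) :
    x ∈ closure Ω ↔ 0 ≤ height e γ x := by
  constructor
  · intro hcl
    by_contra! hlt
    have hU : IsOpen (N ∩ {z | height e γ z < 0}) :=
      h.isOpen.inter (isOpen_lt h.continuous_height continuous_const)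
    obtain ⟨z, ⟨hzN, hz⟩, hzΩ⟩ := _root_.mem_closure_iff.1 hcl _ hU ⟨hx, hlt⟩
    have := (h.mem_iff z hzN).1 hzΩ
    exact lt_asymm this hz
  · intro h0
    have ht : Tendsto (fun s : ℝ => x + s • e) (𝓝[>] 0) (𝓝 x) := by
      have hc : Continuous fun s : ℝ => x + s • e := by fun_prop
      have := hc.tendsto 0
      rw [zero_smul, add_zero] at this
      exact this.mono_left nhdsWithin_le_nhds
    refine mem_closure_of_tendsto ht ?_
    filter_upwards [ht.eventually (h.isOpen.mem_nhds hx), self_mem_nhdsWithin] with s hs hs0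
    rw [h.mem_iff _ hs]
    have h1 : x + s • e = graphMap e γ ((ℝ ∙ e)ᗮ.orthogonalProjectionOnto x)
        + (height e γ x + s) • e := by
      rw [add_smul, ← add_assoc, graphMap_add_height h.norm_eq]
    rw [h1, height_graphMap_add h.norm_eq]
    exact add_pos_of_nonneg_of_pos h0 hs0

theorem mem_frontier_iff (h : IsLocalEpigraph Ω N e γ K) (hΩ : IsOpen Ω) {x : V n} (hx : x ∈ N) :
    x ∈ frontier Ω ↔ height e γ x = 0 := by
  rw [hΩ.frontier_eq, Set.mem_sdiff, h.mem_closure_iff hx, h.mem_iff x hx, not_lt]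
  exact ⟨fun h => le_antisymm h.2 h.1, fun h => ⟨h.ge, h.le⟩⟩

theorem frontier_inter_eq (h : IsLocalEpigraph Ω N e γ K) (hΩ : IsOpen Ω) :
    frontier Ω ∩ N = range (graphMap e γ) ∩ N := by
  ext x
  refine and_congr_left fun hx => ?_
  rw [h.mem_frontier_iff hΩ hx, mem_range_graphMap_iff h.norm_eq]

theorem graphMap_mem_frontier (h : IsLocalEpigraph Ω N e γ K) (hΩ : IsOpen Ω) {v : (ℝ ∙ e)ᗮ}
    (hv : graphMap e γ v ∈ N) : graphMap e γ v ∈ frontier Ω := by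
  rw [h.mem_frontier_iff hΩ hv]
  simpa using height_graphMap_add h.norm_eq γ v 0

/-- To first order `height` at `z` is `-J ⟪z - x, ν⟫`, where `J` is the area factor, with error at
most `ε |z - x|`. Since `J ≥ 1`, the error cannot change the sign outside the `ε`-cone around the
tangent plane. -/
theorem isOuterUnitNormal_graphNormal (h : IsLocalEpigraph Ω N e γ K)
    {v : (ℝ ∙ e)ᗮ} (hv : graphMap e γ v ∈ N) (hd : DifferentiableAt ℝ γ v) :
    IsOuterUnitNormal Ω (graphMap e γ v) (graphNormal e γ v) := by
  refine ⟨norm_graphNormal h.norm_eq γ v, fun ε hε => ?_⟩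
  set ℓ := fderiv ℝ γ v
  set P := (ℝ ∙ e)ᗮ.orthogonalProjectionOnto
  have hP0 : P (graphMap e γ v) = v := by
    simpa using orthogonalProjectionOnto_graphMap_add (e := e) γ v 0
  have hPt : Tendsto (fun z => P z) (𝓝 (graphMap e γ v)) (𝓝 v) := by
    have := P.continuous.tendsto (graphMap e γ v)
    rwa [hP0] at this
  have ho := hPt.eventually (hd.hasFDerivAt.isLittleO.def hε)
  have hJ := one_le_areaFactor ℓ
  have hinn (w : V n) : areaFactor ℓ * ⟪w, graphNormal e γ v⟫ = ℓ (P w) - ⟪w, e⟫ :=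
    areaFactor_mul_inner_graphNormal γ v w
  filter_upwards [ho, h.isOpen.mem_nhds hv] with z hz hzN
  rw [h.mem_iff z hzN]
  set w := z - graphMap e γ v with hw
  have hPw : P z - v = P w := by rw [hw, map_sub, hP0]
  have hnw : ‖P w‖ ≤ ‖w‖ := Submodule.norm_orthogonalProjectionOnto_apply_le _ _
  have hge : ⟪w, e⟫ = ⟪z, e⟫ - γ v := by
    rw [hw, inner_sub_left, graphMap, inner_coe_add_smul h.norm_eq]
  have hz' : |γ (P z) - γ v - ℓ (P w)| ≤ ε * ‖w‖ := by
    rw [← hPw]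
    refine (show _ ≤ ε * ‖P z - v‖ from hz).trans ?_
    rw [hPw]; gcongr
  obtain ⟨ha, hb⟩ := abs_le.1 hz'
  have hi := hinn w
  have hht : height e γ z = ⟪z, e⟫ - γ (P z) := rfl
  have hJw : ε * ‖w‖ ≤ areaFactor ℓ * (ε * ‖w‖) := le_mul_of_one_le_left (by positivity) hJ
  constructor
  · intro hlt
    have := mul_lt_mul_of_pos_left hlt (show 0 < areaFactor ℓ by linarith)
    rw [hht]
    nlinarith
  · intro hlt
    have := mul_lt_mul_of_pos_left hlt (show 0 < areaFactor ℓ by linarith)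
    rw [hht]
    push Not
    nlinarith

theorem ae_outerNormal_eq (h : IsLocalEpigraph Ω N e γ K) :
    ∀ᵐ v, graphMap e γ v ∈ N → outerNormal Ω (graphMap e γ v) = graphNormal e γ v := by
  filter_upwards [h.lip.ae_differentiableAt] with v hd hv
  exact (h.isOuterUnitNormal_graphNormal hv hd).outerNormal_eq

/-- The unit vector `e` forces `n ≥ 1`, so the truncated subtraction in `surfaceMeasure` gives the
true dimension of the graph. -/
theorem finrank_orthogonal (h : IsLocalEpigraph Ω N e γ K) :
    Module.finrank ℝ (ℝ ∙ e)ᗮ = n - 1 := by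
  have he : e ≠ 0 := by rintro rfl; simpa using h.norm_eq
  have h1 := Submodule.finrank_add_finrank_orthogonal (ℝ ∙ e)
  rw [finrank_span_singleton he, finrank_euclideanSpace_fin] at h1
  omega

/-- The weighted measure whose image under `graphMap` is the surface measure. -/
def graphMeasure (e : V n) (γ : (ℝ ∙ e)ᗮ → ℝ) : Measure (ℝ ∙ e)ᗮ :=
  volume.withDensity fun v => ENNReal.ofReal (areaFactor (fderiv ℝ γ v))

theorem surfaceMeasure_restrict (h : IsLocalEpigraph Ω N e γ K) :
    (surfaceMeasure n).restrict (range (graphMap e γ)) =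
      (graphMeasure e γ).map (graphMap e γ) := by
  rw [surfaceMeasure, ← h.finrank_orthogonal]
  exact euclideanHausdorffMeasure_restrict_range_graphMap h.norm_eq h.lip

theorem surfaceMeasure_restrict_frontier_inter (h : IsLocalEpigraph Ω N e γ K) (hΩ : IsOpen Ω)
    {U : Set (V n)} (hU : MeasurableSet U) (hUN : U ⊆ N) :
    (surfaceMeasure n).restrict (frontier Ω ∩ U) =
      ((graphMeasure e γ).restrict (graphMap e γ ⁻¹' U)).map (graphMap e γ) := by
  have h1 : frontier Ω ∩ U = U ∩ range (graphMap e γ) := by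
    have := congrArg (U ∩ ·) (h.frontier_inter_eq hΩ)
    simp only [inter_left_comm U, inter_eq_self_of_subset_left hUN] at this
    rw [this, inter_comm]
  rw [h1, ← Measure.restrict_restrict hU, h.surfaceMeasure_restrict,
    Measure.restrict_map (continuous_graphMap h.lip.continuous).measurable hU]

theorem areaFactor_fderiv_le (h : IsLocalEpigraph Ω N e γ K) (v : (ℝ ∙ e)ᗮ) :
    areaFactor (fderiv ℝ γ v) ≤ 1 + K := by
  have h1 : ‖fderiv ℝ γ v‖ ≤ K := norm_fderiv_le_of_lipschitz ℝ h.lip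
  refine Real.sqrt_le_iff.2 ⟨by positivity, ?_⟩
  have := norm_nonneg (fderiv ℝ γ v)
  nlinarith

theorem surfaceMeasure_frontier_inter_lt_top (h : IsLocalEpigraph Ω N e γ K) (hΩ : IsOpen Ω)
    {U : Set (V n)} (hU : MeasurableSet U) (hUN : U ⊆ N) (hb : Bornology.IsBounded U) :
    surfaceMeasure n (frontier Ω ∩ U) < ⊤ := by
  have hG := (continuous_graphMap (e := e) h.lip.continuous).measurable
  have h1 : surfaceMeasure n (frontier Ω ∩ U) = graphMeasure e γ (graphMap e γ ⁻¹' U) := by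
    have := congrArg (fun μ : Measure (V n) => μ univ)
      (h.surfaceMeasure_restrict_frontier_inter hΩ hU hUN)
    simpa [Measure.map_apply hG MeasurableSet.univ] using this
  have hbd : Bornology.IsBounded (graphMap e γ ⁻¹' U) := by
    obtain ⟨R, hR⟩ := hb.exists_norm_le
    refine isBounded_iff_forall_norm_le.2 ⟨R, fun v hv => ?_⟩
    refine le_trans ?_ (hR _ hv)
    have h2 := Submodule.norm_orthogonalProjectionOnto_apply_le (ℝ ∙ e)ᗮ (graphMap e γ v)
    have h3 := orthogonalProjectionOnto_graphMap_add (e := e) γ v 0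
    rw [zero_smul, add_zero] at h3
    rwa [h3] at h2
  rw [h1, graphMeasure, withDensity_apply _ (hG hU)]
  refine setLIntegral_lt_top_of_le_nnreal hbd.measure_lt_top.ne ⟨1 + K, fun v _ => ?_⟩
  rw [← ENNReal.ofReal_coe_nnreal]
  exact ENNReal.ofReal_le_ofReal (by simpa using h.areaFactor_fderiv_le v)

/-- `outerNormal` is defined by choice; its measurability comes from almost everywhere agreement
with the explicit `graphNormal`. -/
theorem aestronglyMeasurable_outerNormal (h : IsLocalEpigraph Ω N e γ K) (hΩ : IsOpen Ω)
    {U : Set (V n)} (hU : MeasurableSet U) (hUN : U ⊆ N) :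
    AEStronglyMeasurable (outerNormal Ω) ((surfaceMeasure n).restrict (frontier Ω ∩ U)) := by
  rw [h.surfaceMeasure_restrict_frontier_inter hΩ hU hUN,
    (measurableEmbedding_graphMap h.lip.continuous).aestronglyMeasurable_map_iff]
  have hG := (continuous_graphMap (e := e) h.lip.continuous).measurable
  refine (measurable_graphNormal γ).aestronglyMeasurable.congr ?_
  rw [EventuallyEq, ae_restrict_iff' (hG hU)]
  have := (withDensity_absolutelyContinuous volume
    fun v => ENNReal.ofReal (areaFactor (fderiv ℝ γ v))) h.ae_outerNormal_eq
  filter_upwards [this] with v hv hvU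
  exact (hv (hUN hvU)).symm

/-- Surface integrals in graph coordinates. -/
theorem setIntegral_frontier_eq (h : IsLocalEpigraph Ω N e γ K) (hΩ : IsOpen Ω) {f : V n → ℝ}
    (hf : ∀ x ∉ N, f x = 0) :
    ∫ x in frontier Ω, f x ∂(surfaceMeasure n) =
      ∫ v, areaFactor (fderiv ℝ γ v) * f (graphMap e γ v) := by
  have h1 : ∫ x in frontier Ω, f x ∂(surfaceMeasure n) =
      ∫ x in frontier Ω ∩ N, f x ∂(surfaceMeasure n) := by
    refine (setIntegral_eq_of_subset_of_forall_sdiff_eq_zero isClosed_frontier.measurableSet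
      inter_subset_left fun x hx => hf x fun hxN => hx.2 ⟨hx.1, hxN⟩)
  have hemb := measurableEmbedding_graphMap (e := e) h.lip.continuous
  have hG := (continuous_graphMap (e := e) h.lip.continuous).measurable
  rw [h1, h.surfaceMeasure_restrict_frontier_inter hΩ h.isOpen.measurableSet subset_rfl,
    hemb.integral_map, graphMeasure]
  rw [setIntegral_eq_integral_of_forall_compl_eq_zero
    (s := graphMap e γ ⁻¹' N) (f := fun v => f (graphMap e γ v)) fun v hv => hf _ hv]
  rw [integral_withDensity_eq_integral_toReal_smul
    (measurable_areaFactor_fderiv γ).ennreal_ofReal (by simp)]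
  refine integral_congr_ae (Eventually.of_forall fun v => ?_)
  have := one_le_areaFactor (fderiv ℝ γ v)
  simp only [smul_eq_mul]
  rw [ENNReal.toReal_ofReal (by linarith)]

end IsLocalEpigraph

end Local

/-! ### Cutoffs -/

/-- The derivative `ρ` of a smooth step function `θ` from `0` to `1`. -/
theorem exists_smooth_step : ∃ θ ρ : ℝ → ℝ, (∀ u, HasDerivAt θ (ρ u) u) ∧ Continuous ρ ∧
    HasCompactSupport ρ ∧ (∀ u ≤ 1, θ u = 0) ∧ (∀ u, 2 ≤ u → θ u = 1) ∧
    (∀ u, |θ u| ≤ 1) ∧ (∀ u < 1, ρ u = 0) ∧ ∫ u, ρ u = 1 := by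
  -- The shift puts the transition in `[1, 2]`, so that `θ(height / c)` vanishes up to height `c`
  -- and multiplication by it moves supports into `Ω`.
  set θ : ℝ → ℝ := fun u => Real.smoothTransition (u - 1)
  have hθ : ContDiff ℝ 1 θ := Real.smoothTransition.contDiff.comp (contDiff_id.sub contDiff_const)
  have h0 (u : ℝ) (hu : u ≤ 1) : θ u = 0 := Real.smoothTransition.zero_of_nonpos (by linarith)
  have h1 (u : ℝ) (hu : 2 ≤ u) : θ u = 1 := Real.smoothTransition.one_of_one_le (by linarith)
  have hd (u : ℝ) : HasDerivAt θ (deriv θ u) u := (hθ.differentiable (by simp) u).hasDerivAt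
  have hρc : Continuous (deriv θ) := hθ.continuous_deriv le_rfl
  have hρ0 (u : ℝ) (hu : u < 1) : deriv θ u = 0 := by
    have : θ =ᶠ[𝓝 u] fun _ => 0 := by
      filter_upwards [Iio_mem_nhds hu] with z hz using h0 z (le_of_lt hz)
    rw [this.deriv_eq, deriv_const]
  have hρ1 (u : ℝ) (hu : 2 < u) : deriv θ u = 0 := by
    have : θ =ᶠ[𝓝 u] fun _ => 1 := by
      filter_upwards [Ioi_mem_nhds hu] with z hz using h1 z (le_of_lt hz)
    rw [this.deriv_eq, deriv_const]
  have hsupp : HasCompactSupport (deriv θ) := by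
    refine HasCompactSupport.intro (isCompact_Icc (a := (1 : ℝ)) (b := 2)) fun u hu => ?_
    rcases lt_or_ge u 1 with h | h
    · exact hρ0 u h
    · exact hρ1 u (not_le.1 fun h' => hu ⟨h, h'⟩)
  refine ⟨θ, deriv θ, hd, hρc, hsupp, h0, h1, fun u => ?_, hρ0, ?_⟩
  · rw [abs_of_nonneg (Real.smoothTransition.nonneg _)]
    exact Real.smoothTransition.le_one _
  · have := integral_of_hasDerivAt_of_tendsto hd (hρc.integrable_of_hasCompactSupport hsupp)
      (m := 0) (n := 1) ?_ ?_
    · simpa using this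
    · exact tendsto_const_nhds.congr' (by
        filter_upwards [Iic_mem_atBot (1 : ℝ)] with u hu using (h0 u hu).symm)
    · exact tendsto_const_nhds.congr' (by
        filter_upwards [Ici_mem_atTop (2 : ℝ)] with u hu using (h1 u hu).symm)

/-- The factor `g`, such as the position field, may be unbounded: in the product rule for
differences it only has to be bounded at a point of the support of `f`, and the roles of the two
points can be exchanged. -/
theorem lipschitzWith_smul_of_hasCompactSupport {X F : Type*} [PseudoMetricSpace X]
    [NormedAddCommGroup F] [NormedSpace ℝ F] {f : X → ℝ} {g : X → F} {K K' : ℝ≥0}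
    (hf : LipschitzWith K f) (hc : HasCompactSupport f) (hg : LipschitzWith K' g) :
    ∃ C : ℝ≥0, LipschitzWith C fun x => f x • g x := by
  obtain ⟨A, hA⟩ := hc.exists_bound_of_continuous hf.continuous
  obtain ⟨M, hM⟩ := hc.isCompact.exists_bound_of_continuousOn hg.continuous.continuousOn
  set A' := max A 0
  set M' := max M 0
  have key (x y : X) (hx : f x ≠ 0) :
      dist (f x • g x) (f y • g y) ≤ (K * M' + A' * K') * dist x y := by
    have h1 : f x • g x - f y • g y = (f x - f y) • g x + f y • (g x - g y) := by module
    have h2 := hf.dist_le_mul x y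
    have h3 := hg.dist_le_mul x y
    rw [dist_eq_norm] at h2 h3
    have h4 : ‖g x‖ ≤ M' := (hM x (subset_tsupport _ hx)).trans (le_max_left _ _)
    have h5 : ‖f y‖ ≤ A' := (hA y).trans (le_max_left _ _)
    rw [dist_eq_norm, h1]
    refine (norm_add_le _ _).trans ?_
    rw [norm_smul, norm_smul]
    calc _ ≤ K * dist x y * M' + A' * (K' * dist x y) := by
          gcongr
      _ = _ := by ring
  have hnn : 0 ≤ K * M' + A' * K' := by positivity
  refine ⟨⟨K * M' + A' * K', hnn⟩, LipschitzWith.of_dist_le_mul fun x y => ?_⟩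
  by_cases hx : f x = 0
  · by_cases hy : f y = 0
    · rw [hx, hy, zero_smul, zero_smul, dist_self]; exact mul_nonneg hnn dist_nonneg
    · rw [dist_comm, dist_comm x y]; exact key y x hy
  · exact key x y hx

/-! ### The divergence theorem near a boundary point -/

/-- `B` has the distributional divergence `g` in `Ω`, tested against Lipschitz functions. -/
def HasWeakDiv {n : ℕ} (Ω : Set (V n)) (B : V n → V n) (g : V n → ℝ) : Prop :=
  ∀ (K : ℝ≥0) (ζ : V n → ℝ), LipschitzWith K ζ → HasCompactSupport ζ → tsupport ζ ⊆ Ω →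
    ∫ x in Ω, (ζ x * g x + fderiv ℝ ζ x (B x)) = 0

namespace IsLocalEpigraph

variable {n : ℕ} {Ω N : Set (V n)} {e : V n} {γ : (ℝ ∙ e)ᗮ → ℝ} {K : ℝ≥0}

/-- Rademacher's theorem in `e^⊥` concerns null sets of the hyperplane; shear coordinates turn them
into null cylinders in the full space. -/
theorem ae_hasFDerivAt_height (h : IsLocalEpigraph Ω N e γ K) :
    ∀ᵐ x : V n, HasFDerivAt (height e γ)
      (innerSL ℝ e - (fderiv ℝ γ ((ℝ ∙ e)ᗮ.orthogonalProjectionOnto x)).comp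
        (ℝ ∙ e)ᗮ.orthogonalProjectionOnto) x := by
  have hae : ∀ᵐ x : V n, DifferentiableAt ℝ γ ((ℝ ∙ e)ᗮ.orthogonalProjectionOnto x) := by
    rw [← (measurePreserving_shearMap_one h.norm_eq h.lip.continuous).map_eq,
      ae_map_iff (continuous_shearMap h.lip.continuous 1).aemeasurable]
    · simp only [shearMap, orthogonalProjectionOnto_graphMap_add]
      exact Measure.quasiMeasurePreserving_fst.ae h.lip.ae_differentiableAt
    · exact (ℝ ∙ e)ᗮ.orthogonalProjectionOnto.continuous.measurable
        (measurableSet_of_differentiableAt ℝ γ)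
  filter_upwards [hae] with x hx
  have h1 : HasFDerivAt (fun x : V n => ⟪x, e⟫) (innerSL ℝ e) x := by
    have := (innerSL ℝ e).hasFDerivAt (x := x)
    refine this.congr_of_eventuallyEq (Eventually.of_forall fun z => ?_)
    simp [real_inner_comm]
  exact h1.sub (hx.hasFDerivAt.comp x (ℝ ∙ e)ᗮ.orthogonalProjectionOnto.hasFDerivAt)

/-- The singular part of the divergence of a field cut off at distance `c` from the boundary. -/
def layer (B : V n → V n) (χ : V n → ℝ) (ρ : ℝ → ℝ) (e : V n) (γ : (ℝ ∙ e)ᗮ → ℝ) (c : ℝ)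
    (x : V n) : ℝ :=
  c⁻¹ * (ρ (height e γ x / c) * (χ x * (⟪B x, e⟫ -
    fderiv ℝ γ ((ℝ ∙ e)ᗮ.orthogonalProjectionOnto x) ((ℝ ∙ e)ᗮ.orthogonalProjectionOnto (B x)))))

/-- Measuring height in units of `c` makes the profile `ρ` independent of `c`, and the Jacobian
absorbs the singular factor `c⁻¹`. Only the evaluation point still depends on `c`. -/
theorem layer_shearMap (he : ‖e‖ = 1) (B : V n → V n) (χ : V n → ℝ) (ρ : ℝ → ℝ)
    {c : ℝ} (hc : 0 < c) (p : (ℝ ∙ e)ᗮ × ℝ) :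
    c * layer B χ ρ e γ c (shearMap e γ c p) =
      ρ p.2 * (χ (shearMap e γ c p) * (⟪B (shearMap e γ c p), e⟫ -
        fderiv ℝ γ p.1 ((ℝ ∙ e)ᗮ.orthogonalProjectionOnto (B (shearMap e γ c p))))) := by
  have h1 : height e γ (shearMap e γ c p) / c = p.2 := by
    rw [shearMap, height_graphMap_add he, mul_div_cancel_left₀ _ hc.ne']
  have h2 : (ℝ ∙ e)ᗮ.orthogonalProjectionOnto (shearMap e γ c p) = p.1 :=
    orthogonalProjectionOnto_graphMap_add _ _ _
  rw [layer, mul_inv_cancel_left₀ hc.ne', h1, h2]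

theorem aestronglyMeasurable_layer (h : IsLocalEpigraph Ω N e γ K) {B : V n → V n} {χ : V n → ℝ}
    {ρ : ℝ → ℝ} {c : ℝ} {μ : Measure (V n)} (hB : AEStronglyMeasurable B μ) (hχ : Continuous χ)
    (hρ : Continuous ρ) : AEStronglyMeasurable (layer B χ ρ e γ c) μ := by
  have h1 : Measurable fun x => fderiv ℝ γ ((ℝ ∙ e)ᗮ.orthogonalProjectionOnto x) :=
    (measurable_fderiv ℝ γ).comp (ℝ ∙ e)ᗮ.orthogonalProjectionOnto.continuous.measurable
  have h2 := (ℝ ∙ e)ᗮ.orthogonalProjectionOnto.continuous.comp_aestronglyMeasurable hB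
  have h3 : Continuous fun p : ((ℝ ∙ e)ᗮ →L[ℝ] ℝ) × (ℝ ∙ e)ᗮ => p.1 p.2 := by fun_prop
  have h4 := h1.aestronglyMeasurable (μ := μ).prodMk h2
  have h5 := h3.comp_aestronglyMeasurable h4
  have h6 : AEStronglyMeasurable (fun x => ⟪B x, e⟫) μ := hB.inner aestronglyMeasurable_const
  have h7 : Continuous fun x => ρ (height e γ x / c) :=
    hρ.comp (h.continuous_height.div_const c)
  have h8 := h7.aestronglyMeasurable (μ := μ).mul (hχ.aestronglyMeasurable.mul (h6.sub h5))
  exact h8.const_mul c⁻¹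

theorem abs_inner_sub_fderiv_le (h : IsLocalEpigraph Ω N e γ K) (v : (ℝ ∙ e)ᗮ) (w : V n) :
    |⟪w, e⟫ - fderiv ℝ γ v ((ℝ ∙ e)ᗮ.orthogonalProjectionOnto w)| ≤ (1 + K) * ‖w‖ := by
  have h1 : |⟪w, e⟫| ≤ ‖w‖ := by simpa [h.norm_eq] using abs_real_inner_le_norm w e
  have h2 : |fderiv ℝ γ v ((ℝ ∙ e)ᗮ.orthogonalProjectionOnto w)| ≤ K * ‖w‖ := by
    refine ((fderiv ℝ γ v).le_opNorm _).trans ?_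
    exact mul_le_mul (norm_fderiv_le_of_lipschitz ℝ h.lip)
      (Submodule.norm_orthogonalProjectionOnto_apply_le _ _) (norm_nonneg _) K.2
  refine (abs_sub _ _).trans ?_
  linarith

/-- As the cutoff distance tends to `0`, the boundary layer produces the flux through `∂Ω`. -/
theorem tendsto_integral_layer (h : IsLocalEpigraph Ω N e γ K) (hΩ : IsOpen Ω)
    {B : V n → V n} (hBm : AEStronglyMeasurable B (volume.restrict Ω))
    (hBc : ContinuousOn B (closure Ω ∩ N)) {χ : V n → ℝ} (hχ : Continuous χ)
    (hχc : HasCompactSupport χ) (hχN : tsupport χ ⊆ N) {ρ : ℝ → ℝ} (hρ : Continuous ρ)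
    (hρc : HasCompactSupport ρ) (hρ0 : ∀ u < 1, ρ u = 0) (hρ1 : ∫ u, ρ u = 1)
    {c : ℕ → ℝ} (hc : ∀ i, 0 < c i) (hc0 : Tendsto c atTop (𝓝 0)) :
    Tendsto (fun i => ∫ x in Ω, layer B χ ρ e γ (c i) x) atTop
      (𝓝 (-∫ x in frontier Ω, χ x * ⟪B x, outerNormal Ω x⟫ ∂(surfaceMeasure n))) := by
  -- The layer integrals pulled back to a fixed product space. Dominated convergence gives the limit
  -- `f(v) ρ(s)`, whose integral in `s` contributes the factor `∫ ρ = 1`.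
  set F : ℕ → (ℝ ∙ e)ᗮ × ℝ → ℝ := fun i p =>
    c i * Ω.indicator (layer B χ ρ e γ (c i)) (shearMap e γ (c i) p) with hF
  set f : (ℝ ∙ e)ᗮ → ℝ := fun v => -(areaFactor (fderiv ℝ γ v) *
    (χ (graphMap e γ v) * ⟪B (graphMap e γ v), graphNormal e γ v⟫)) with hf
  have hmeas (i) : AEStronglyMeasurable (Ω.indicator (layer B χ ρ e γ (c i))) volume :=
    (aestronglyMeasurable_indicator_iff hΩ.measurableSet).2 (h.aestronglyMeasurable_layer hBm hχ hρ)
  have hint (i) : ∫ x in Ω, layer B χ ρ e γ (c i) x = ∫ p, F i p ∂(volume.prod volume) := by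
    rw [hF, integral_shearMap h.norm_eq h.lip.continuous (hc i) (hmeas i),
      integral_indicator hΩ.measurableSet]
  have hflux : -∫ x in frontier Ω, χ x * ⟪B x, outerNormal Ω x⟫ ∂(surfaceMeasure n) =
      ∫ p : (ℝ ∙ e)ᗮ × ℝ, f p.1 * ρ p.2 ∂(volume.prod volume) := by
    rw [integral_prod_mul, hρ1, mul_one, h.setIntegral_frontier_eq hΩ, ← integral_neg]
    · refine integral_congr_ae ?_
      filter_upwards [h.ae_outerNormal_eq] with v hv
      by_cases hvN : graphMap e γ v ∈ N
      · simp only [hf, hv hvN]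
      · have : χ (graphMap e γ v) = 0 := image_eq_zero_of_notMem_tsupport fun h' => hvN (hχN h')
        simp [hf, this]
    · intro x hx
      rw [image_eq_zero_of_notMem_tsupport fun h' => hx (hχN h'), zero_mul]
  have hFon (i) (p) (hp : shearMap e γ (c i) p ∈ Ω) : F i p =
      ρ p.2 * (χ (shearMap e γ (c i) p) * (⟪B (shearMap e γ (c i) p), e⟫ -
        fderiv ℝ γ p.1 ((ℝ ∙ e)ᗮ.orthogonalProjectionOnto (B (shearMap e γ (c i) p))))) := by
    simp only [hF]
    rw [indicator_of_mem hp, layer_shearMap h.norm_eq _ _ _ (hc i)]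
  have hFoff (i) (p) (hp : shearMap e γ (c i) p ∉ Ω) : F i p = 0 := by
    simp only [hF]
    rw [indicator_of_notMem hp, mul_zero]
  -- `B` is controlled only in `closure Ω ∩ N`; compactness of `tsupport χ ∩ closure Ω` suffices, as
  -- `χ` vanishes elsewhere.
  obtain ⟨C, hC0, hC⟩ : ∃ C, 0 ≤ C ∧ ∀ x ∈ closure Ω, |χ x| * ‖B x‖ ≤ C := by
    have hcomp : IsCompact (tsupport χ ∩ closure Ω) := hχc.isCompact.inter_right isClosed_closure
    have hcont : ContinuousOn B (tsupport χ ∩ closure Ω) :=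
      hBc.mono fun x hx => ⟨hx.2, hχN hx.1⟩
    obtain ⟨C, hC⟩ := hcomp.exists_bound_of_continuousOn (hχ.continuousOn.smul hcont)
    refine ⟨max C 0, le_max_right _ _, fun x hx => ?_⟩
    by_cases hxs : x ∈ tsupport χ
    · refine le_trans ?_ ((hC x ⟨hxs, hx⟩).trans (le_max_left _ _))
      rw [Pi.smul_apply', norm_smul, Real.norm_eq_abs]
    · rw [image_eq_zero_of_notMem_tsupport hxs, abs_zero, zero_mul]
      exact le_max_right _ _
  obtain ⟨R, hR⟩ := hχc.isCompact.isBounded.exists_norm_le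
  have hpoint (p : (ℝ ∙ e)ᗮ × ℝ) : Tendsto (fun i => shearMap e γ (c i) p) atTop
      (𝓝 (graphMap e γ p.1)) := by
    have h1 : Continuous fun t : ℝ => graphMap e γ p.1 + (t * p.2) • e := by fun_prop
    have h2 := (h1.tendsto 0).comp hc0
    simp only [zero_mul, zero_smul, add_zero] at h2
    exact h2
  simp only [hint]
  rw [hflux]
  refine tendsto_integral_of_dominated_convergence
    (fun p => (Metric.closedBall (0 : (ℝ ∙ e)ᗮ) R).indicator (fun _ => (1 + K) * C) p.1 * |ρ p.2|)
    (fun i => ?_) ?_ (fun i => ?_) ?_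
  · exact ((hmeas i).comp_quasiMeasurePreserving
      (quasiMeasurePreserving_shearMap h.norm_eq h.lip.continuous (hc i))).const_mul _
  · refine Integrable.mul_prod ?_ (hρ.integrable_of_hasCompactSupport hρc).abs
    rw [integrable_indicator_iff Metric.isClosed_closedBall.measurableSet]
    exact integrableOn_const (isCompact_closedBall _ _).measure_lt_top.ne
  · refine Eventually.of_forall fun p => ?_
    have hnn : 0 ≤ (Metric.closedBall (0 : (ℝ ∙ e)ᗮ) R).indicator (fun _ => (1 + K) * C) p.1 *
        |ρ p.2| := by
      refine mul_nonneg (indicator_nonneg (fun _ _ => ?_) _) (abs_nonneg _)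
      positivity
    by_cases hp : shearMap e γ (c i) p ∈ Ω
    swap
    · rw [hFoff i p hp, norm_zero]; exact hnn
    by_cases hs : χ (shearMap e γ (c i) p) = 0
    · rw [hFon i p hp, hs, zero_mul, mul_zero, norm_zero]; exact hnn
    have hball : p.1 ∈ Metric.closedBall (0 : (ℝ ∙ e)ᗮ) R := by
      rw [mem_closedBall_zero_iff]
      have h1 := Submodule.norm_orthogonalProjectionOnto_apply_le (ℝ ∙ e)ᗮ (shearMap e γ (c i) p)
      rw [shearMap, orthogonalProjectionOnto_graphMap_add] at h1
      exact h1.trans (hR _ (subset_tsupport _ hs))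
    rw [hFon i p hp, indicator_of_mem hball, norm_mul, mul_comm, norm_mul, Real.norm_eq_abs,
      Real.norm_eq_abs, Real.norm_eq_abs]
    refine mul_le_mul_of_nonneg_right ?_ (abs_nonneg _)
    calc _ ≤ |χ (shearMap e γ (c i) p)| * ((1 + K) * ‖B (shearMap e γ (c i) p)‖) :=
          mul_le_mul_of_nonneg_left (h.abs_inner_sub_fderiv_le _ _) (abs_nonneg _)
      _ = (1 + K) * (|χ (shearMap e γ (c i) p)| * ‖B (shearMap e γ (c i) p)‖) := by ring
      _ ≤ _ := mul_le_mul_of_nonneg_left (hC _ (subset_closure hp)) (by positivity)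
  · refine Eventually.of_forall fun p => ?_
    -- Where `ρ` can be nonzero the rescaled height is positive, so the sheared points approach the
    -- graph from inside `Ω` and one-sided continuity of `B` applies.
    by_cases hσ : p.2 < 1
    · have hz (i) : F i p = 0 := by
        by_cases hp : shearMap e γ (c i) p ∈ Ω
        · rw [hFon i p hp, hρ0 _ hσ, zero_mul]
        · exact hFoff i p hp
      simp only [hz, hρ0 _ hσ, mul_zero]
      exact tendsto_const_nhds
    have hσ' : 0 < p.2 := by linarith
    by_cases hpN : graphMap e γ p.1 ∈ N
    · have hev : ∀ᶠ i in atTop, shearMap e γ (c i) p ∈ Ω ∩ N := by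
        filter_upwards [(hpoint p).eventually (h.isOpen.mem_nhds hpN)] with i hi
        refine ⟨?_, hi⟩
        rw [h.mem_iff _ hi, shearMap, height_graphMap_add h.norm_eq]
        exact mul_pos (hc i) hσ'
      have hmem : graphMap e γ p.1 ∈ closure Ω ∩ N :=
        ⟨frontier_subset_closure (h.graphMap_mem_frontier hΩ hpN), hpN⟩
      have hBt : Tendsto (fun i => B (shearMap e γ (c i) p)) atTop (𝓝 (B (graphMap e γ p.1))) := by
        refine (hBc _ hmem).tendsto.comp (tendsto_nhdsWithin_iff.2 ⟨hpoint p, ?_⟩)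
        filter_upwards [hev] with i hi using ⟨subset_closure hi.1, hi.2⟩
      have hχt := (hχ.tendsto (graphMap e γ p.1)).comp (hpoint p)
      have hwc : Continuous fun w : V n =>
          ⟪w, e⟫ - fderiv ℝ γ p.1 ((ℝ ∙ e)ᗮ.orthogonalProjectionOnto w) := by fun_prop
      have hwt := (hwc.tendsto (B (graphMap e γ p.1))).comp hBt
      have hlim := (hχt.mul hwt).const_mul (ρ p.2)
      have heq : f p.1 * ρ p.2 = ρ p.2 * (χ (graphMap e γ p.1) *
          (⟪B (graphMap e γ p.1), e⟫ -
            fderiv ℝ γ p.1 ((ℝ ∙ e)ᗮ.orthogonalProjectionOnto (B (graphMap e γ p.1))))) := by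
        have := areaFactor_mul_inner_graphNormal γ p.1 (B (graphMap e γ p.1))
        simp only [hf]
        linear_combination (-(ρ p.2) * χ (graphMap e γ p.1)) * this
      rw [heq]
      refine hlim.congr' ?_
      filter_upwards [hev] with i hi
      exact (hFon i p hi.1).symm
    · have hns : graphMap e γ p.1 ∉ tsupport χ := fun h' => hpN (hχN h')
      have hev : ∀ᶠ i in atTop, F i p = 0 := by
        filter_upwards [(hpoint p).eventually
          ((isClosed_tsupport χ).isOpen_compl.mem_nhds hns)] with i hi
        by_cases hp : shearMap e γ (c i) p ∈ Ω
        · rw [hFon i p hp, image_eq_zero_of_notMem_tsupport hi, zero_mul, mul_zero]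
        · exact hFoff i p hp
      have hz : f p.1 * ρ p.2 = 0 := by
        simp only [hf]
        rw [image_eq_zero_of_notMem_tsupport hns]
        ring
      rw [hz]
      exact tendsto_const_nhds.congr' (hev.mono fun i hi => hi.symm)

theorem _root_.Elasticity.integrableOn_fderiv_apply {B : V n → V n} (hB : IntegrableOn B Ω)
    {χ : V n → ℝ} (hχ : ContDiff ℝ 1 χ) {K : ℝ≥0} (hK : LipschitzWith K χ) :
    IntegrableOn (fun x => fderiv ℝ χ x (B x)) Ω := by
  have h1 : Continuous (fderiv ℝ χ) := hχ.continuous_fderiv one_ne_zero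
  have h2 : Continuous fun p : (V n →L[ℝ] ℝ) × V n => p.1 p.2 := by fun_prop
  have h3 := h1.aestronglyMeasurable (μ := volume.restrict Ω).prodMk hB.1
  have h4 := h2.comp_aestronglyMeasurable h3
  refine (hB.norm.const_mul K).mono' h4 (Eventually.of_forall fun x => ?_)
  exact ((fderiv ℝ χ x).le_opNorm _).trans
    (mul_le_mul_of_nonneg_right (norm_fderiv_le_of_lipschitz ℝ hK) (norm_nonneg _))

/-- The divergence theorem for a field localized near a boundary point. -/
theorem setIntegral_div_eq_flux (h : IsLocalEpigraph Ω N e γ K) (hΩ : IsOpen Ω)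
    {B : V n → V n} {g : V n → ℝ} (hB : IntegrableOn B Ω) (hg : IntegrableOn g Ω)
    (hBc : ContinuousOn B (closure Ω ∩ N)) (hdiv : HasWeakDiv Ω B g) {χ : V n → ℝ}
    (hχ : ContDiff ℝ 1 χ) (hχc : HasCompactSupport χ) (hχN : tsupport χ ⊆ N) :
    ∫ x in Ω, (χ x * g x + fderiv ℝ χ x (B x)) =
      ∫ x in frontier Ω, χ x * ⟪B x, outerNormal Ω x⟫ ∂(surfaceMeasure n) := by
  obtain ⟨θ, ρ, hθd, hρ, hρc, hθ0, hθ1, hθb, hρ0, hρ1⟩ := exists_smooth_step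
  obtain ⟨Kχ, hKχ⟩ := ContDiff.lipschitzWith_of_hasCompactSupport hχc hχ one_ne_zero
  obtain ⟨Cρ, hCρ⟩ := hρc.exists_bound_of_continuous hρ
  obtain ⟨Cχ, hCχ⟩ := hχc.exists_bound_of_continuous hχ.continuous
  have hθlip : LipschitzWith (Real.toNNReal Cρ) θ := by
    refine lipschitzWith_of_nnnorm_deriv_le (fun u => (hθd u).differentiableAt) fun u => ?_
    rw [(hθd u).deriv, ← NNReal.coe_le_coe]
    exact (hCρ u).trans (Real.le_coe_toNNReal _)
  have hθc : Continuous θ := hθlip.continuous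
  set c : ℕ → ℝ := fun i => 1 / ((i : ℝ) + 1)
  have hc (i) : 0 < c i := by positivity
  have hc0 : Tendsto c atTop (𝓝 0) := tendsto_one_div_add_atTop_nhds_zero_nat
  -- `χ η` is an admissible Lipschitz test function supported in `Ω`. In its gradient the term with
  -- `∇χ` converges by dominated convergence and the term with `∇η` is exactly `layer`.
  set η : ℕ → V n → ℝ := fun i x => θ (height e γ x / c i)
  have hηc (i) : Continuous (η i) := hθc.comp (h.continuous_height.div_const _)
  have hηlip (i) : ∃ C, LipschitzWith C (η i) := by
    have h1 : LipschitzWith ⟨(c i)⁻¹, (inv_pos.2 (hc i)).le⟩ fun t : ℝ => t / c i :=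
      LipschitzWith.of_dist_le_mul fun s t => by
        rw [Real.dist_eq, Real.dist_eq, ← sub_div, abs_div, abs_of_pos (hc i), div_eq_inv_mul]
        rfl
    exact ⟨_, hθlip.comp (h1.comp (lipschitzWith_height h.norm_eq h.lip))⟩
  have hsub (i) : tsupport (fun x => χ x • η i x) ⊆ Ω := by
    have h1 : tsupport (fun x => χ x • η i x) ⊆ tsupport χ ∩ {x | c i ≤ height e γ x} := by
      refine closure_minimal (fun x hx => ?_) ((isClosed_tsupport χ).inter
        (isClosed_le continuous_const h.continuous_height))
      have hx' : χ x • η i x ≠ 0 := hx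
      refine ⟨subset_tsupport _ (left_ne_zero_of_smul hx'), ?_⟩
      by_contra hlt
      refine right_ne_zero_of_smul hx' (hθ0 _ ?_)
      rw [div_le_one (hc i)]
      exact (not_le.1 hlt).le
    intro x hx
    obtain ⟨hx1, hx2⟩ := h1 hx
    exact (h.mem_iff x (hχN hx1)).2 ((hc i).trans_le hx2)
  have hzero (i) : ∫ x in Ω, (χ x * η i x * g x +
      fderiv ℝ (fun x => χ x • η i x) x (B x)) = 0 := by
    obtain ⟨C, hC⟩ := hηlip i
    obtain ⟨C', hC'⟩ := lipschitzWith_smul_of_hasCompactSupport hKχ hχc hC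
    exact hdiv C' _ hC' hχc.smul_right (hsub i)
  have hfd (i) : ∀ᵐ x : V n, fderiv ℝ (fun x => χ x • η i x) x (B x) =
      η i x * fderiv ℝ χ x (B x) + layer B χ ρ e γ (c i) x := by
    filter_upwards [h.ae_hasFDerivAt_height] with x hx
    have h1 : HasFDerivAt (η i) _ x :=
      (hθd (height e γ x / c i)).comp_hasFDerivAt x (hx.mul_const (c i)⁻¹)
    have h2 := ((hχ.differentiable one_ne_zero x).hasFDerivAt).smul h1
    rw [show (fun x => χ x • η i x) = χ • η i from rfl, h2.fderiv]
    simp [layer, real_inner_comm]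
    ring
  set G : ℕ → V n → ℝ := fun i x => η i x * (χ x * g x + fderiv ℝ χ x (B x)) with hG
  have hχg : IntegrableOn (fun x => χ x * g x) Ω :=
    hg.bdd_mul hχ.continuous.aestronglyMeasurable (Eventually.of_forall hCχ)
  have hχB : IntegrableOn (fun x => fderiv ℝ χ x (B x)) Ω := integrableOn_fderiv_apply hB hχ hKχ
  have hlayer (i) : IntegrableOn (layer B χ ρ e γ (c i)) Ω := by
    refine (hB.norm.const_mul ((c i)⁻¹ * (Cρ * (Cχ * (1 + K))))).mono'
      (h.aestronglyMeasurable_layer hB.1 hχ.continuous hρ) (Eventually.of_forall fun x => ?_)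
    rw [layer, norm_mul, norm_mul, norm_mul, Real.norm_of_nonneg (inv_pos.2 (hc i)).le,
      mul_assoc, mul_assoc, mul_assoc]
    have h1 := hCρ (height e γ x / c i)
    have h2 := hCχ x
    have h3 := (norm_nonneg _).trans h1
    have h4 := (norm_nonneg _).trans h2
    refine mul_le_mul_of_nonneg_left ?_ (inv_pos.2 (hc i)).le
    refine mul_le_mul h1 ?_ (by positivity) h3
    exact mul_le_mul h2 (h.abs_inner_sub_fderiv_le _ _) (norm_nonneg _) h4
  have hGint (i) : IntegrableOn (G i) Ω :=
    (hχg.add hχB).bdd_mul (hηc i).aestronglyMeasurable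
      (Eventually.of_forall fun x => hθb (height e γ x / c i))
  have hsum (i) : ∫ x in Ω, G i x = -∫ x in Ω, layer B χ ρ e γ (c i) x := by
    rw [eq_neg_iff_add_eq_zero, ← integral_add (hGint i) (hlayer i), ← hzero i]
    refine integral_congr_ae ?_
    filter_upwards [ae_restrict_of_ae (hfd i)] with x hx
    rw [hx]
    simp only [hG]
    ring
  have hlim1 := (h.tendsto_integral_layer hΩ hB.1 hBc hχ.continuous hχc hχN hρ hρc hρ0 hρ1
    hc hc0).neg
  rw [neg_neg] at hlim1
  have hlim2 : Tendsto (fun i => ∫ x in Ω, G i x) atTop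
      (𝓝 (∫ x in Ω, (χ x * g x + fderiv ℝ χ x (B x)))) := by
    refine tendsto_integral_of_dominated_convergence
      (fun x => ‖χ x * g x + fderiv ℝ χ x (B x)‖) (fun i => (hGint i).1) (hχg.add hχB).norm
      (fun i => Eventually.of_forall fun x => ?_) ?_
    · simp only [hG]
      rw [norm_mul]
      exact mul_le_of_le_one_left (norm_nonneg _) (hθb _)
    · filter_upwards [ae_restrict_mem hΩ.measurableSet] with x hx
      by_cases hxN : x ∈ N
      · have hpos := (h.mem_iff x hxN).1 hx
        refine tendsto_const_nhds.congr' ?_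
        have := hc0.eventually (Iio_mem_nhds (show 0 < height e γ x / 2 by positivity))
        filter_upwards [this] with i hi
        have : η i x = 1 := by
          refine hθ1 _ ?_
          rw [le_div_iff₀ (hc i)]
          have : c i < height e γ x / 2 := hi
          linarith
        simp only [hG, this, one_mul]
      · have hns : x ∉ tsupport χ := fun h' => hxN (hχN h')
        have h1 : χ x = 0 := image_eq_zero_of_notMem_tsupport hns
        have h2 : fderiv ℝ χ x = 0 := by
          refine image_eq_zero_of_notMem_tsupport fun h' => hns (tsupport_fderiv_subset ℝ h')
        simp [hG, h1, h2]
  simp only [hsum] at hlim2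
  exact tendsto_nhds_unique hlim2 hlim1

end IsLocalEpigraph

/-! ### The divergence theorem on Lipschitz domains -/

section Divergence

variable {n : ℕ} {Ω : Set (V n)}

theorem norm_outerNormal_le_one (Ω : Set (V n)) (x : V n) : ‖outerNormal Ω x‖ ≤ 1 := by
  by_cases h : ∃ ν, IsOuterUnitNormal Ω x ν
  · obtain ⟨ν, hν⟩ := h
    rw [hν.outerNormal_eq, hν.1]
  · rw [outerNormal, dif_neg h, norm_zero]
    exact zero_le_one

theorem isCompact_frontier_of_isBounded (hb : Bornology.IsBounded Ω) : IsCompact (frontier Ω) :=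
  Metric.isCompact_of_isClosed_isBounded isClosed_frontier
    (hb.closure.subset frontier_subset_closure)

theorem HasLipschitzBoundary.exists_nhds (hL : HasLipschitzBoundary Ω) (hΩ : IsOpen Ω) {p : V n}
    (hp : p ∈ frontier Ω) :
    ∃ s ∈ 𝓝[frontier Ω] p, surfaceMeasure n s < ⊤ ∧
      AEStronglyMeasurable (outerNormal Ω) ((surfaceMeasure n).restrict s) := by
  obtain ⟨e, γ, K, N, hpN, h⟩ := hL.exists_isLocalEpigraph hp
  have hU : IsOpen (N ∩ Metric.ball p 1) := h.isOpen.inter Metric.isOpen_ball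
  refine ⟨frontier Ω ∩ (N ∩ Metric.ball p 1), inter_mem self_mem_nhdsWithin
    (mem_nhdsWithin_of_mem_nhds (hU.mem_nhds ⟨hpN, Metric.mem_ball_self one_pos⟩)), ?_, ?_⟩
  · exact h.surfaceMeasure_frontier_inter_lt_top hΩ hU.measurableSet inter_subset_left
      (Metric.isBounded_ball.subset inter_subset_right)
  · exact h.aestronglyMeasurable_outerNormal hΩ hU.measurableSet inter_subset_left

theorem HasLipschitzBoundary.surfaceMeasure_frontier_lt_top (hL : HasLipschitzBoundary Ω)
    (hΩ : IsOpen Ω) (hb : Bornology.IsBounded Ω) : surfaceMeasure n (frontier Ω) < ⊤ := by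
  refine (isCompact_frontier_of_isBounded hb).measure_lt_top_of_nhdsWithin fun p hp => ?_
  obtain ⟨s, hs, hlt, -⟩ := hL.exists_nhds hΩ hp
  exact ⟨s, hs, hlt⟩

theorem HasLipschitzBoundary.integrableOn_outerNormal (hL : HasLipschitzBoundary Ω)
    (hΩ : IsOpen Ω) (hb : Bornology.IsBounded Ω) :
    IntegrableOn (outerNormal Ω) (frontier Ω) (surfaceMeasure n) := by
  refine LocallyIntegrableOn.integrableOn_isCompact (fun p hp => ?_)
    (isCompact_frontier_of_isBounded hb)
  obtain ⟨s, hs, hlt, hm⟩ := hL.exists_nhds hΩ hp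
  exact ⟨s, hs, IntegrableOn.of_bound hlt hm 1
    (Eventually.of_forall fun x => norm_outerNormal_le_one Ω x)⟩

/-- A continuous expression in the point and the outer normal is integrable on the boundary. -/
theorem HasLipschitzBoundary.integrableOn_frontier (hL : HasLipschitzBoundary Ω)
    (hΩ : IsOpen Ω) (hb : Bornology.IsBounded Ω) {f : V n × V n → ℝ}
    (hf : ContinuousOn f (frontier Ω ×ˢ univ)) :
    IntegrableOn (fun x => f (x, outerNormal Ω x)) (frontier Ω) (surfaceMeasure n) := by
  have hcpt := isCompact_frontier_of_isBounded hb
  have hms : MeasurableSet (frontier Ω ×ˢ (univ : Set (V n))) :=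
    isClosed_frontier.measurableSet.prod MeasurableSet.univ
  obtain ⟨C, hC⟩ := (hcpt.prod (isCompact_closedBall (0 : V n) 1)).exists_bound_of_continuousOn
    (hf.mono (prod_mono_right (subset_univ _)))
  have hν := (hL.integrableOn_outerNormal hΩ hb).1
  -- Extension by zero gives a globally Borel function, which can be composed with the merely almost
  -- everywhere measurable normal.
  have hind : StronglyMeasurable ((frontier Ω ×ˢ (univ : Set (V n))).indicator f) := by
    refine Measurable.stronglyMeasurable ?_
    classical
    have h1 := hf.measurable_piecewise (g := (0 : V n × V n → ℝ)) continuousOn_const hms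
    rwa [piecewise_eq_indicator] at h1
  have hid : AEMeasurable (fun x : V n => x) ((surfaceMeasure n).restrict (frontier Ω)) :=
    aemeasurable_id
  have hpair := hid.prodMk hν.aemeasurable
  have hcomp := hind.measurable.comp_aemeasurable hpair
  refine IntegrableOn.of_bound (hL.surfaceMeasure_frontier_lt_top hΩ hb)
    (hcomp.aestronglyMeasurable.congr ?_) C ?_
  · filter_upwards [ae_restrict_mem isClosed_frontier.measurableSet] with x hx
    have hmem : (x, outerNormal Ω x) ∈ frontier Ω ×ˢ (univ : Set (V n)) := ⟨hx, mem_univ _⟩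
    exact indicator_of_mem hmem f
  · filter_upwards [ae_restrict_mem isClosed_frontier.measurableSet] with x hx
    exact hC _ ⟨hx, by simpa using norm_outerNormal_le_one Ω x⟩

/-- The predicate `P` carries a local statement along with each set of the cover, so that interior
and boundary neighborhoods can be treated by one finite sum. -/
theorem exists_smooth_partition {S : Set (V n)} (hS : IsCompact S) {P : Set (V n) → Prop}
    (hP : ∀ x ∈ S, ∃ U, x ∈ U ∧ IsOpen U ∧ Bornology.IsBounded U ∧ P U) :
    ∃ (ι : Type) (_ : Fintype ι) (χ : ι → V n → ℝ) (U : ι → Set (V n)),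
      (∀ i, ContDiff ℝ 1 (χ i) ∧ HasCompactSupport (χ i) ∧ tsupport (χ i) ⊆ U i ∧ P (U i)) ∧
      ∀ x ∈ S, ∑ i, χ i x = 1 := by
  choose! U hxU hUo hUb hUP using hP
  obtain ⟨t, htS, htc⟩ := hS.elim_nhds_subcover U fun x hx => (hUo x hx).mem_nhds (hxU x hx)
  obtain ⟨f, hf⟩ := SmoothPartitionOfUnity.exists_isSubordinate (modelWithCornersSelf ℝ (V n))
    hS.isClosed (fun i : t => U i) (fun i => hUo _ (htS _ i.2)) (by
      refine htc.trans ?_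
      simp [iUnion_subtype])
  refine ⟨t, inferInstance, fun i => f i, fun i => U i, fun i => ⟨?_, ?_, hf i, hUP _ (htS _ i.2)⟩,
    fun x hx => ?_⟩
  · exact (contMDiff_iff_contDiff.1 (f i).contMDiff).of_le (by simp)
  · exact Metric.isCompact_of_isClosed_isBounded (isClosed_tsupport _)
      ((hUb _ (htS _ i.2)).subset (hf i))
  · rw [← f.sum_eq_one hx, finsum_eq_sum_of_fintype]

/-- The **divergence theorem** on a bounded Lipschitz domain, for a field which is continuous up to
the boundary near `∂Ω` and has an integrable distributional divergence. -/
theorem HasLipschitzBoundary.integral_div_eq_flux (hL : HasLipschitzBoundary Ω) (hΩ : IsOpen Ω)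
    (hb : Bornology.IsBounded Ω) {B : V n → V n} {g : V n → ℝ} (hB : IntegrableOn B Ω)
    (hg : IntegrableOn g Ω) {N : Set (V n)} (hN : IsOpen N) (hfN : frontier Ω ⊆ N)
    (hBc : ContinuousOn B (closure Ω ∩ N)) (hdiv : HasWeakDiv Ω B g) :
    ∫ x in Ω, g x = ∫ x in frontier Ω, ⟪B x, outerNormal Ω x⟫ ∂(surfaceMeasure n) := by
  -- The local statement is the divergence theorem for `χ B`. In the interior both sides vanish, the
  -- left by definition of the weak divergence; near `∂Ω` it is `setIntegral_div_eq_flux`.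
  obtain ⟨ι, _, χ, U, hχ, hsum⟩ := exists_smooth_partition (S := closure Ω)
    (P := fun U => ∀ χ : V n → ℝ, ContDiff ℝ 1 χ → HasCompactSupport χ → tsupport χ ⊆ U →
      ∫ x in Ω, (χ x * g x + fderiv ℝ χ x (B x)) =
        ∫ x in frontier Ω, χ x * ⟪B x, outerNormal Ω x⟫ ∂(surfaceMeasure n))
    hb.isCompact_closure fun p hp => by
      by_cases hpΩ : p ∈ Ω
      · refine ⟨Ω, hpΩ, hΩ, hb, fun χ hχ hχc hχΩ => ?_⟩
        obtain ⟨C, hC⟩ := ContDiff.lipschitzWith_of_hasCompactSupport hχc hχ one_ne_zero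
        rw [hdiv C χ hC hχc hχΩ]
        refine (setIntegral_eq_zero_of_forall_eq_zero fun x hx => ?_).symm
        rw [hΩ.frontier_eq] at hx
        rw [image_eq_zero_of_notMem_tsupport fun h' => hx.2 (hχΩ h'), zero_mul]
      · have hpf : p ∈ frontier Ω := by rw [hΩ.frontier_eq]; exact ⟨hp, hpΩ⟩
        obtain ⟨e, γ, K, N', hpN', h⟩ := hL.exists_isLocalEpigraph hpf
        have hUo : IsOpen (N' ∩ (N ∩ Metric.ball p 1)) :=
          h.isOpen.inter (hN.inter Metric.isOpen_ball)
        refine ⟨N' ∩ (N ∩ Metric.ball p 1), ⟨hpN', hfN hpf, Metric.mem_ball_self one_pos⟩, hUo,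
          Metric.isBounded_ball.subset (inter_subset_right.trans inter_subset_right),
          fun χ hχ hχc hχU => ?_⟩
        exact (h.mono hUo inter_subset_left).setIntegral_div_eq_flux hΩ hB hg
          (hBc.mono fun x hx => ⟨hx.1, hx.2.2.1⟩) hdiv hχ hχc hχU
  have hint (i) : IntegrableOn (fun x => χ i x * g x + fderiv ℝ (χ i) x (B x)) Ω := by
    obtain ⟨Cχ, hCχ⟩ := (hχ i).2.1.exists_bound_of_continuous (hχ i).1.continuous
    obtain ⟨K, hK⟩ := ContDiff.lipschitzWith_of_hasCompactSupport (hχ i).2.1 (hχ i).1 one_ne_zero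
    exact (hg.bdd_mul (hχ i).1.continuous.aestronglyMeasurable (Eventually.of_forall hCχ)).add
      (integrableOn_fderiv_apply hB (hχ i).1 hK)
  have hintS (i) : IntegrableOn (fun x => χ i x * ⟪B x, outerNormal Ω x⟫) (frontier Ω)
      (surfaceMeasure n) := by
    refine hL.integrableOn_frontier hΩ hb (f := fun q => χ i q.1 * ⟪B q.1, q.2⟫) ?_
    have h1 : ContinuousOn (fun q : V n × V n => B q.1) (frontier Ω ×ˢ univ) :=
      hBc.comp continuousOn_fst fun q hq => ⟨frontier_subset_closure hq.1, hfN hq.1⟩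
    have h2 := h1.inner (𝕜 := ℝ) continuousOn_snd
    exact ((hχ i).1.continuous.comp continuous_fst).continuousOn.mul h2
  have h1 : ∫ x in Ω, g x = ∫ x in Ω, ∑ i, (χ i x * g x + fderiv ℝ (χ i) x (B x)) := by
    refine setIntegral_congr_fun hΩ.measurableSet fun x hx => ?_
    -- The cutoffs sum to `1` on an open neighborhood of `x`, so the error terms with `∇χ` cancel in
    -- the sum.
    have hev : (fun z => ∑ i, χ i z) =ᶠ[𝓝 x] fun _ => 1 := by
      filter_upwards [hΩ.mem_nhds hx] with z hz using hsum z (subset_closure hz)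
    have hd : ∑ i, fderiv ℝ (χ i) x = 0 := by
      have := hev.fderiv_eq (𝕜 := ℝ)
      rwa [fderiv_fun_sum fun i _ => (hχ i).1.differentiable one_ne_zero x,
        fderiv_fun_const] at this
    have hd' := congrArg (fun L : V n →L[ℝ] ℝ => L (B x)) hd
    simp only [sum_apply, zero_apply] at hd'
    simp only [Finset.sum_add_distrib, hd', ← Finset.sum_mul, hsum x (subset_closure hx), one_mul,
      add_zero]
  rw [h1, integral_finsetSum _ fun i _ => hint i,
    Finset.sum_congr rfl fun i _ => (hχ i).2.2.2 (χ i) (hχ i).1 (hχ i).2.1 (hχ i).2.2.1,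
    ← integral_finsetSum _ fun i _ => hintS i]
  refine setIntegral_congr_fun isClosed_frontier.measurableSet fun x hx => ?_
  simp only [← Finset.sum_mul, hsum x (frontier_subset_closure hx), one_mul]

end Divergence

/-! ### Matrix identities -/

section Algebra

variable {n m : ℕ}

theorem frob_eq_sum_inner (A B : Mat m n) :
    frob A B = ∑ α, ⟪A (EuclideanSpace.single α 1), B (EuclideanSpace.single α 1)⟫ := by
  rw [frob, Finset.sum_comm]
  refine Finset.sum_congr rfl fun α _ => ?_
  rw [PiLp.inner_apply]
  refine Finset.sum_congr rfl fun i _ => ?_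
  simp [mul_comm]

theorem sum_inner_smul_single (x : V n) :
    ∑ α, ⟪EuclideanSpace.single α (1 : ℝ), x⟫ • EuclideanSpace.single α (1 : ℝ) = x := by
  simpa using (EuclideanSpace.basisFun (Fin n) ℝ).sum_repr' x

theorem frob_add_right (A B C : Mat m n) : frob A (B + C) = frob A B + frob A C := by
  simp [frob_eq_sum_inner, inner_add_right, Finset.sum_add_distrib]

theorem frob_smul_right (A B : Mat m n) (c : ℝ) : frob A (c • B) = c * frob A B := by
  simp [frob_eq_sum_inner, inner_smul_right, Finset.mul_sum]

/-- When the gradient in a weak equation falls on the scalar factor of a test field `ζ u`, this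
turns the resulting term into `∇ζ` applied to the vector field `Mᵀ u`. -/
theorem frob_smulRight (A : Mat m n) (ℓ : V n →L[ℝ] ℝ) (y : V m) :
    frob A (ℓ.smulRight y) = ℓ (ContinuousLinearMap.adjoint A y) := by
  rw [frob_eq_sum_inner]
  conv_rhs => rw [← sum_inner_smul_single (ContinuousLinearMap.adjoint A y)]
  rw [map_sum]
  refine Finset.sum_congr rfl fun α _ => ?_
  rw [map_smul, ContinuousLinearMap.smulRight_apply, inner_smul_right,
    ContinuousLinearMap.adjoint_inner_right, smul_eq_mul, mul_comm]

/-- The trace of `Fᵀ P` cancels `⟨P, F⟩` column by column, leaving one `W` for each of the `n` basis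
vectors. -/
theorem frob_eshelby_id (W : Density n m) (p : V n × V m × Mat m n) :
    frob (eshelby W p) (ContinuousLinearMap.id ℝ (V n)) + frob (piola W p) p.2.2 = n * W p := by
  simp only [frob_eq_sum_inner, ← Finset.sum_add_distrib]
  have h (α : Fin n) : ⟪eshelby W p (EuclideanSpace.single α 1),
      ContinuousLinearMap.id ℝ (V n) (EuclideanSpace.single α 1)⟫ +
      ⟪piola W p (EuclideanSpace.single α 1), p.2.2 (EuclideanSpace.single α 1)⟫ = W p := by
    simp only [eshelby, sub_apply, smul_apply, ContinuousLinearMap.id_apply,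
      ContinuousLinearMap.comp_apply, inner_sub_left, inner_smul_left,
      ContinuousLinearMap.adjoint_inner_left]
    simp
  rw [Finset.sum_congr rfl fun α _ => h α]
  simp

/-- For `D = b ⊗ ν` the product with `A` only sees `A ν`. It reduces `⟨P₁, F₂ - F₁⟩` in the excess
to boundary tractions. -/
theorem frob_of_rank_one {A D : Mat m n} {ν : V n} (hD : ∀ w, D w = ⟪w, ν⟫ • D ν) :
    frob A D = ⟪A ν, D ν⟫ := by
  rw [frob_eq_sum_inner]
  conv_rhs => rw [← sum_inner_smul_single ν, map_sum, sum_inner, sum_inner_smul_single]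
  refine Finset.sum_congr rfl fun α _ => ?_
  rw [hD, inner_smul_right, map_smul, inner_smul_left]
  simp

end Algebra

/-! ### Regularity of the energy density and of the stress tensors -/

section Density

variable {n m : ℕ} {W : Density n m} {𝒰 : Set (V n × V m × Mat m n)}

theorem hasFDerivAt_of_mem (h𝒰 : IsOpen 𝒰) (hW : ContDiffOn ℝ 1 W 𝒰) {p} (hp : p ∈ 𝒰) :
    HasFDerivAt W (fderiv ℝ W p) p :=
  ((hW.contDiffAt (h𝒰.mem_nhds hp)).differentiableAt one_ne_zero).hasFDerivAt

theorem dX_eq (h𝒰 : IsOpen 𝒰) (hW : ContDiffOn ℝ 1 W 𝒰) {p} (hp : p ∈ 𝒰) :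
    dX W p = (fderiv ℝ W p).comp (ContinuousLinearMap.inl ℝ (V n) (V m × Mat m n)) := by
  have h1 : HasFDerivAt (fun x : V n => (x, p.2)) (ContinuousLinearMap.inl ℝ (V n) (V m × Mat m n))
      p.1 := hasFDerivAt_prodMk_left p.1 p.2
  exact (HasFDerivAt.comp (g := W) p.1 (hasFDerivAt_of_mem h𝒰 hW hp) h1).fderiv

theorem dY_eq (h𝒰 : IsOpen 𝒰) (hW : ContDiffOn ℝ 1 W 𝒰) {p} (hp : p ∈ 𝒰) :
    dY W p = (fderiv ℝ W p).comp ((ContinuousLinearMap.inr ℝ (V n) (V m × Mat m n)).comp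
      (ContinuousLinearMap.inl ℝ (V m) (Mat m n))) := by
  have h1 : HasFDerivAt (fun y : V m => (y, p.2.2)) (ContinuousLinearMap.inl ℝ (V m) (Mat m n))
      p.2.1 := hasFDerivAt_prodMk_left p.2.1 p.2.2
  have h2 : HasFDerivAt (fun q : V m × Mat m n => (p.1, q))
      (ContinuousLinearMap.inr ℝ (V n) (V m × Mat m n)) p.2 := hasFDerivAt_prodMk_right p.1 p.2
  have h3 := HasFDerivAt.comp (f := fun y : V m => (y, p.2.2)) p.2.1 h2 h1
  exact (HasFDerivAt.comp (g := W) p.2.1 (hasFDerivAt_of_mem h𝒰 hW hp) h3).fderiv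

theorem dF_apply (h𝒰 : IsOpen 𝒰) (hW : ContDiffOn ℝ 1 W 𝒰) {p} (hp : p ∈ 𝒰) (H : Mat m n) :
    dF W p H = fderiv ℝ W p (0, 0, H) := by
  have h1 : HasFDerivAt (fun F : Mat m n => (p.2.1, F)) (ContinuousLinearMap.inr ℝ (V m) (Mat m n))
      p.2.2 := hasFDerivAt_prodMk_right p.2.1 p.2.2
  have h2 : HasFDerivAt (fun q : V m × Mat m n => (p.1, q))
      (ContinuousLinearMap.inr ℝ (V n) (V m × Mat m n)) p.2 := hasFDerivAt_prodMk_right p.1 p.2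
  have h3 := HasFDerivAt.comp (f := fun F : Mat m n => (p.2.1, F)) p.2.2 h2 h1
  have h4 := (HasFDerivAt.comp (g := W) p.2.2 (hasFDerivAt_of_mem h𝒰 hW hp) h3).fderiv
  exact congrArg (fun L : Mat m n →L[ℝ] ℝ => L H) h4

theorem continuousOn_dX (h𝒰 : IsOpen 𝒰) (hW : ContDiffOn ℝ 1 W 𝒰) : ContinuousOn (dX W) 𝒰 := by
  have h1 := hW.continuousOn_fderiv_of_isOpen h𝒰 le_rfl
  exact (h1.clm_comp continuousOn_const).congr fun p hp => dX_eq h𝒰 hW hp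

theorem continuousOn_dY (h𝒰 : IsOpen 𝒰) (hW : ContDiffOn ℝ 1 W 𝒰) : ContinuousOn (dY W) 𝒰 := by
  have h1 := hW.continuousOn_fderiv_of_isOpen h𝒰 le_rfl
  exact (h1.clm_comp continuousOn_const).congr fun p hp => dY_eq h𝒰 hW hp

theorem continuousOn_piola (h𝒰 : IsOpen 𝒰) (hW : ContDiffOn ℝ 1 W 𝒰) :
    ContinuousOn (piola W) 𝒰 := by
  have h1 := hW.continuousOn_fderiv_of_isOpen h𝒰 le_rfl
  have h2 (H : Mat m n) : ContinuousOn (fun p => dF W p H) 𝒰 := by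
    have h3 : ContinuousOn (fun p => fderiv ℝ W p (0, 0, H)) 𝒰 := h1.clm_apply continuousOn_const
    exact h3.congr fun p hp => dF_apply h𝒰 hW hp H
  unfold piola
  refine continuousOn_finsetSum _ fun i _ => continuousOn_finsetSum _ fun α _ => ?_
  exact (h2 _).smul continuousOn_const

theorem continuousOn_eshelby (h𝒰 : IsOpen 𝒰) (hW : ContDiffOn ℝ 1 W 𝒰) :
    ContinuousOn (eshelby W) 𝒰 := by
  have h1 := continuousOn_piola h𝒰 hW
  have h2 : ContinuousOn (fun p : V n × V m × Mat m n => ContinuousLinearMap.adjoint p.2.2) 𝒰 :=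
    (ContinuousLinearMap.adjoint.continuous.comp
      (continuous_snd.comp continuous_snd)).continuousOn
  have h3 := h2.clm_comp h1
  have h4 : ContinuousOn (fun p => W p • ContinuousLinearMap.id ℝ (V n)) 𝒰 :=
    hW.continuousOn.smul continuousOn_const
  exact h4.sub h3

/-- The field `P*ᵀ x + Pᵀ y`, whose divergence is `n W` for stationary configurations of a
scale-free energy. -/
def scalingField (W : Density n m) (p : V n × V m × Mat m n) : V n :=
  ContinuousLinearMap.adjoint (eshelby W p) p.1 + ContinuousLinearMap.adjoint (piola W p) p.2.1

theorem continuousOn_scalingField (h𝒰 : IsOpen 𝒰) (hW : ContDiffOn ℝ 1 W 𝒰) :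
    ContinuousOn (scalingField W) 𝒰 := by
  have h1 := ContinuousLinearMap.adjoint.continuous.comp_continuousOn (continuousOn_eshelby h𝒰 hW)
  have h2 := ContinuousLinearMap.adjoint.continuous.comp_continuousOn (continuousOn_piola h𝒰 hW)
  have h3 := h1.clm_apply continuousOn_fst
  have h4 := h2.clm_apply (continuous_fst.comp continuous_snd).continuousOn
  exact h3.add h4

theorem inner_scalingField (W : Density n m) (p : V n × V m × Mat m n) (ν : V n) :
    ⟪scalingField W p, ν⟫ =
      W p * ⟪p.1, ν⟫ - ⟪piola W p ν, p.2.2 p.1⟫ + ⟪piola W p ν, p.2.1⟫ := by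
  rw [scalingField, inner_add_left, ContinuousLinearMap.adjoint_inner_left,
    ContinuousLinearMap.adjoint_inner_left, eshelby]
  simp only [sub_apply, smul_apply, ContinuousLinearMap.id_apply, ContinuousLinearMap.comp_apply,
    inner_sub_right, inner_smul_right, ContinuousLinearMap.adjoint_inner_right]
  rw [real_inner_comm (p.2.2 p.1), real_inner_comm p.2.1]

/-- Euler's identity for scale-free densities. -/
theorem IsScaleFree.euler (hs : IsScaleFree W 𝒰) (h𝒰 : IsOpen 𝒰) (hW : ContDiffOn ℝ 1 W 𝒰)
    {p} (hp : p ∈ 𝒰) : dX W p p.1 + dY W p p.2.1 = 0 := by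
  have h0 : dX W p p.1 + dY W p p.2.1 = fderiv ℝ W p (p.1, p.2.1, 0) := by
    rw [dX_eq h𝒰 hW hp, dY_eq h𝒰 hW hp, ContinuousLinearMap.comp_apply,
      ContinuousLinearMap.comp_apply, ← map_add]
    simp
  rw [h0]
  -- The ray need not stay in `𝒰`, but openness keeps it there for `t` near `1`, which is enough to
  -- differentiate the constant function `W ∘ c` at `1`.
  set c : ℝ → V n × V m × Mat m n := fun t => (t • p.1, t • p.2.1, p.2.2) with hc
  have hc1 : c 1 = p := by simp [hc]
  have hcd : HasDerivAt c (p.1, p.2.1, 0) 1 := by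
    have h1 : HasDerivAt (fun t : ℝ => t • p.1) p.1 1 := by
      simpa using (hasDerivAt_id (1 : ℝ)).smul_const p.1
    have h2 : HasDerivAt (fun t : ℝ => t • p.2.1) p.2.1 1 := by
      simpa using (hasDerivAt_id (1 : ℝ)).smul_const p.2.1
    exact h1.prodMk (h2.prodMk (hasDerivAt_const 1 p.2.2))
  have hWp : HasFDerivAt W (fderiv ℝ W p) (c 1) := by
    rw [hc1]; exact hasFDerivAt_of_mem h𝒰 hW hp
  have h1 := hWp.comp_hasDerivAt (1 : ℝ) hcd
  have hev : (W ∘ c) =ᶠ[𝓝 1] fun _ => W p := by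
    have h2 : ∀ᶠ t in 𝓝 (1 : ℝ), c t ∈ 𝒰 :=
      hcd.continuousAt.eventually (h𝒰.mem_nhds (hc1.symm ▸ hp))
    filter_upwards [h2, Ioi_mem_nhds (zero_lt_one' ℝ)] with t ht ht0
    exact hs t ht0 p.1 p.2.1 p.2.2 hp ht
  exact h1.unique ((hasDerivAt_const (1 : ℝ) (W p)).congr_of_eventuallyEq hev)

end Density

/-! ### Deformation gradients up to the boundary -/

section Jet

variable {n m : ℕ} {Ω : Set (V n)} {y : V n → V m} {𝒰 : Set (V n × V m × Mat m n)}

/-- Above a `K`-Lipschitz graph there is at each point an open convex cone of slope `K`; truncated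
by a ball it lies in `closure Ω`. This makes the one-sided gradient at boundary points unique, hence
continuous up to `∂Ω` for a `C²` map. -/
theorem IsLocalEpigraph.uniqueDiffWithinAt {N : Set (V n)} {e : V n} {γ : (ℝ ∙ e)ᗮ → ℝ} {K : ℝ≥0}
    (h : IsLocalEpigraph Ω N e γ K) {p : V n} (hp : p ∈ N) (hpcl : p ∈ closure Ω) :
    UniqueDiffWithinAt ℝ (closure Ω) p := by
  obtain ⟨r, hr, hrN⟩ := Metric.isOpen_iff.1 h.isOpen p hp
  set P := (ℝ ∙ e)ᗮ.orthogonalProjectionOnto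
  set S : Set (V n) := Metric.ball p r ∩ {z | K * ‖P (z - p)‖ < ⟪z - p, e⟫}
  have hPc : Continuous fun z => K * ‖P (z - p)‖ := by fun_prop
  have hec : Continuous fun z => ⟪z - p, e⟫ := by fun_prop
  have hSo : IsOpen S := Metric.isOpen_ball.inter (isOpen_lt hPc hec)
  have hsub : S ⊆ closure Ω := by
    rintro z ⟨hzb, hz⟩
    have hz' : K * ‖P (z - p)‖ < ⟪z - p, e⟫ := hz
    have h0 := (h.mem_closure_iff hp).1 hpcl
    refine (h.mem_closure_iff (hrN hzb)).2 ?_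
    have h1 := h.lip.dist_le_mul (P z) (P p)
    rw [Real.dist_eq, dist_eq_norm, ← map_sub] at h1
    have h2 := (abs_le.1 h1).2
    rw [inner_sub_left] at hz'
    simp only [height] at h0 ⊢
    linarith
  have hpt (t : ℝ) : K * ‖P (p + t • e - p)‖ = 0 := by
    have h1 := orthogonalProjectionOnto_add_smul (e := e) 0 t
    rw [Submodule.coe_zero, zero_add] at h1
    rw [add_sub_cancel_left, h1, norm_zero, mul_zero]
  have hcv : Convex ℝ S := by
    refine (convex_ball p r).inter ?_
    intro z hz w hw a b ha hb hab
    have hz' : K * ‖P (z - p)‖ < ⟪z - p, e⟫ := hz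
    have hw' : K * ‖P (w - p)‖ < ⟪w - p, e⟫ := hw
    have h1 : a • z + b • w - p = a • (z - p) + b • (w - p) := by
      have : p = (a + b) • p := by rw [hab, one_smul]
      nth_rewrite 1 [this]; module
    show K * ‖P (a • z + b • w - p)‖ < ⟪a • z + b • w - p, e⟫
    rw [h1, map_add, map_smul, map_smul, inner_add_left, inner_smul_left, inner_smul_left]
    have h2 : ‖a • P (z - p) + b • P (w - p)‖ ≤ a * ‖P (z - p)‖ + b * ‖P (w - p)‖ := by
      refine (norm_add_le _ _).trans ?_
      rw [norm_smul, norm_smul, Real.norm_of_nonneg ha, Real.norm_of_nonneg hb]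
    have h3 := mul_le_mul_of_nonneg_left h2 K.coe_nonneg
    simp only [RCLike.conj_to_real]
    -- Strictness comes from `z` when its weight is positive, and otherwise from `w`, whose weight
    -- is then `1`.
    rcases ha.eq_or_lt with rfl | ha'
    · have : b = 1 := by linarith
      subst this
      calc _ ≤ _ := h3
        _ < _ := by linarith
    · have h4 := mul_lt_mul_of_pos_left hz' ha'
      have h5 := mul_le_mul_of_nonneg_left hw'.le hb
      calc _ ≤ _ := h3
        _ < _ := by linarith
  have hin (t : ℝ) (ht : 0 < t) (htr : t < r) : p + t • e ∈ S := by
    refine ⟨?_, ?_⟩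
    · rw [Metric.mem_ball, dist_eq_norm, add_sub_cancel_left, norm_smul, h.norm_eq, mul_one,
        Real.norm_of_nonneg ht.le]
      exact htr
    · show K * ‖P (p + t • e - p)‖ < ⟪p + t • e - p, e⟫
      rw [hpt, add_sub_cancel_left, inner_smul_left, real_inner_self_eq_norm_sq, h.norm_eq]
      simpa using ht
  refine (uniqueDiffWithinAt_convex hcv ?_ ?_).mono hsub
  · rw [hSo.interior_eq]
    exact ⟨_, hin (r / 2) (by positivity) (by linarith)⟩
  · have ht : Tendsto (fun t : ℝ => p + t • e) (𝓝[>] 0) (𝓝 p) := by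
      have hc : Continuous fun s : ℝ => p + s • e := by fun_prop
      have := hc.tendsto 0
      rw [zero_smul, add_zero] at this
      exact this.mono_left nhdsWithin_le_nhds
    refine mem_closure_of_tendsto ht ?_
    filter_upwards [Ioo_mem_nhdsGT hr] with t ht using hin t ht.1 ht.2

theorem HasLipschitzBoundary.uniqueDiffOn_closure (hL : HasLipschitzBoundary Ω) (hΩ : IsOpen Ω) :
    UniqueDiffOn ℝ (closure Ω) := by
  intro p hp
  by_cases hpΩ : p ∈ Ω
  · exact (hΩ.uniqueDiffWithinAt hpΩ).mono subset_closure
  · have hpf : p ∈ frontier Ω := by rw [hΩ.frontier_eq]; exact ⟨hp, hpΩ⟩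
    obtain ⟨e, γ, K, N, hpN, h⟩ := hL.exists_isLocalEpigraph hpf
    exact h.uniqueDiffWithinAt hpN hp

theorem defGrad_eq_of_isOpen {N : Set (V n)} (hN : IsOpen N) {x : V n} (hx : x ∈ N) :
    defGrad Ω y x = fderivWithin ℝ y (closure Ω ∩ N) x :=
  (fderivWithin_inter (hN.mem_nhds hx)).symm

theorem continuousOn_jet (hL : HasLipschitzBoundary Ω) (hΩ : IsOpen Ω) {N : Set (V n)}
    (hN : IsOpen N) (hy : ContDiffOn ℝ 2 y (closure Ω ∩ N)) :
    ContinuousOn (jet Ω y) (closure Ω ∩ N) := by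
  have hu : UniqueDiffOn ℝ (closure Ω ∩ N) := (hL.uniqueDiffOn_closure hΩ).inter hN
  have h1 := (hy.continuousOn_fderivWithin hu (by norm_num)).congr
    fun x hx => defGrad_eq_of_isOpen (Ω := Ω) (y := y) hN hx.2
  exact continuousOn_id.prodMk (hy.continuousOn.prodMk h1)

theorem hasFDerivWithinAt_defGrad {N : Set (V n)} (hN : IsOpen N)
    (hy : ContDiffOn ℝ 2 y (closure Ω ∩ N)) {x : V n} (hx : x ∈ closure Ω) (hxN : x ∈ N) :
    HasFDerivWithinAt y (defGrad Ω y x) (closure Ω) x := by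
  have h1 := hy.differentiableOn two_ne_zero x ⟨hx, hxN⟩
  exact ((differentiableWithinAt_inter (hN.mem_nhds hxN)).1 h1).hasFDerivWithinAt

/-- Where the jet is continuous, its range is in the compact set which contains it almost
everywhere. -/
theorem jet_mem_of_ae_mem (hΩ : IsOpen Ω) {N : Set (V n)} (hN : IsOpen N)
    {K : Set (V n × V m × Mat m n)} (hK : IsClosed K)
    (hae : ∀ᵐ x ∂(volume.restrict Ω), jet Ω y x ∈ K)
    (hc : ContinuousOn (jet Ω y) (closure Ω ∩ N)) {x : V n} (hx : x ∈ closure Ω ∩ N) :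
    jet Ω y x ∈ K := by
  rw [ae_restrict_iff' hΩ.measurableSet] at hae
  -- A set of full measure in an open set is dense in it, since nonempty open sets have positive
  -- volume.
  have hd : x ∈ closure (Ω ∩ N ∩ {z | z ∈ Ω → jet Ω y z ∈ K}) := by
    refine mem_closure_iff.2 fun O hO hxO => ?_
    have hne : (O ∩ N ∩ Ω).Nonempty :=
      mem_closure_iff.1 hx.1 _ (hO.inter hN) ⟨hxO, hx.2⟩
    have hpos : volume (O ∩ N ∩ Ω) ≠ 0 := (((hO.inter hN).inter hΩ).measure_pos volume hne).ne'
    by_contra hcon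
    refine hpos (measure_mono_null (fun z hz => ?_) hae)
    intro hz'
    exact hcon ⟨z, hz.1.1, ⟨hz.2, hz.1.2⟩, hz'⟩
  have hsub : Ω ∩ N ∩ {z | z ∈ Ω → jet Ω y z ∈ K} ⊆ closure Ω ∩ N :=
    fun z hz => ⟨subset_closure hz.1.1, hz.1.2⟩
  have h1 := ((hc x hx).mono hsub).mem_closure hd (t := K) fun z hz => hz.2 hz.1.1
  rwa [hK.closure_eq] at h1

/-- `y` is arbitrary outside `closure Ω`. A global Lipschitz extension gives access to Rademacher's
theorem and to measurability of the derivative, and leaves the jet on `Ω` unchanged. -/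
theorem IsLipschitzConfig.exists_extension (hy : IsLipschitzConfig Ω y) :
    ∃ (C : ℝ≥0) (u : V n → V m), LipschitzWith C u ∧ EqOn y u (closure Ω) := by
  obtain ⟨K, hK⟩ := hy
  obtain ⟨u, hu, heq⟩ := hK.extend_finite_dimension
  exact ⟨_, u, hu, heq⟩

theorem defGrad_eq_fderiv_of_eqOn (hΩ : IsOpen Ω) {u : V n → V m} (h : EqOn y u (closure Ω))
    {x : V n} (hx : x ∈ Ω) : defGrad Ω y x = fderiv ℝ u x := by
  rw [defGrad_eq_fderiv hΩ y hx]
  refine Filter.EventuallyEq.fderiv_eq ?_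
  filter_upwards [hΩ.mem_nhds hx] with z hz using h (subset_closure hz)

theorem IsLipschitzConfig.aemeasurable_jet (hy : IsLipschitzConfig Ω y) (hΩ : IsOpen Ω) :
    AEMeasurable (jet Ω y) (volume.restrict Ω) := by
  obtain ⟨C, u, hu, heq⟩ := hy.exists_extension
  have hm : Measurable fun x => (x, u x, fderiv ℝ u x) :=
    measurable_id.prodMk (hu.continuous.measurable.prodMk (measurable_fderiv ℝ u))
  refine ⟨_, hm, ?_⟩
  filter_upwards [ae_restrict_mem hΩ.measurableSet] with x hx
  rw [jet, heq (subset_closure hx), defGrad_eq_fderiv_of_eqOn hΩ heq hx]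

/-- Continuous functions of the jet are integrable. -/
theorem integrableOn_comp_jet {G : Type*} [NormedAddCommGroup G] (hΩ : IsOpen Ω)
    (hb : Bornology.IsBounded Ω) (hy : IsLipschitzConfig Ω y) (hr : HasRangeIn Ω y 𝒰)
    {f : V n × V m × Mat m n → G} (hf : ContinuousOn f 𝒰) :
    IntegrableOn (fun x => f (jet Ω y x)) Ω := by
  obtain ⟨K, hK, hK𝒰, hae⟩ := hr
  have hj := hy.aemeasurable_jet hΩ
  have hfK := hf.mono hK𝒰
  obtain ⟨C, hC⟩ := hK.exists_bound_of_continuousOn hfK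
  have hmap : ∀ᵐ p ∂((volume.restrict Ω).map (jet Ω y)), p ∈ K :=
    (ae_map_iff hj hK.measurableSet).2 hae
  have h1 := hfK.aestronglyMeasurable_of_isCompact hK hK.measurableSet
    (μ := (volume.restrict Ω).map (jet Ω y))
  rw [Measure.restrict_eq_self_of_ae_mem hmap] at h1
  have h2 := h1.comp_aemeasurable hj
  refine IntegrableOn.of_bound hb.measure_lt_top h2 C ?_
  filter_upwards [hae] with x hx using hC _ hx

end Jet

/-! ### The scaling identity for stationary configurations -/

section Scaling

variable {n m : ℕ} {Ω : Set (V n)} {W : Density n m} {𝒰 : Set (V n × V m × Mat m n)}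
  {y : V n → V m}

/-- Lipschitz multiples of a Lipschitz field are admissible in a weak equation. -/
theorem weak_equation_smul {k : ℕ} (hΩ : IsOpen Ω) {L : V n → V k →L[ℝ] ℝ} {M : V n → Mat k n}
    (hL : IntegrableOn L Ω) (hM : IntegrableOn M Ω)
    (h : ∀ φ : V n → V k, IsTestField Ω φ →
      ∫ x in Ω, (L x (φ x) + frob (M x) (fderiv ℝ φ x)) = 0)
    {u : V n → V k} {C : ℝ≥0} (hu : LipschitzWith C u) {ζ : V n → ℝ} {K : ℝ≥0}
    (hζ : LipschitzWith K ζ) (hζc : HasCompactSupport ζ) (hζΩ : tsupport ζ ⊆ Ω) :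
    IntegrableOn (fun x => ζ x * (L x (u x) + frob (M x) (fderiv ℝ u x)) +
      fderiv ℝ ζ x (ContinuousLinearMap.adjoint (M x) (u x))) Ω ∧
    ∫ x in Ω, (ζ x * (L x (u x) + frob (M x) (fderiv ℝ u x)) +
      fderiv ℝ ζ x (ContinuousLinearMap.adjoint (M x) (u x))) = 0 := by
  obtain ⟨C', hC'⟩ := lipschitzWith_smul_of_hasCompactSupport hζ hζc hu
  have hcs : HasCompactSupport fun x => ζ x • u x := hζc.smul_right
  have h1 := weak_equation_of_lipschitz hΩ hL hM h hC' hcs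
    ((tsupport_smul_subset_left ζ u).trans hζΩ)
  have h2 : ∀ᵐ x ∂(volume.restrict Ω),
      L x (ζ x • u x) + frob (M x) (fderiv ℝ (fun x => ζ x • u x) x) =
      ζ x * (L x (u x) + frob (M x) (fderiv ℝ u x)) +
      fderiv ℝ ζ x (ContinuousLinearMap.adjoint (M x) (u x)) := by
    filter_upwards [ae_restrict_of_ae hζ.ae_differentiableAt,
      ae_restrict_of_ae hu.ae_differentiableAt] with x hx1 hx2
    have h3 : fderiv ℝ (fun x => ζ x • u x) x =
        ζ x • fderiv ℝ u x + (fderiv ℝ ζ x).smulRight (u x) :=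
      (hx1.hasFDerivAt.smul hx2.hasFDerivAt).fderiv
    rw [h3, frob_add_right, frob_smul_right, frob_smulRight, map_smul, smul_eq_mul]
    ring
  refine ⟨?_, by rw [← integral_congr_ae h2]; exact h1⟩
  obtain ⟨D, hD⟩ := hcs.exists_bound_of_continuous hC'.continuous
  have hmeas : AEStronglyMeasurable
      (fun x => L x (ζ x • u x) + frob (M x) (fderiv ℝ (fun x => ζ x • u x) x))
      (volume.restrict Ω) :=
    aestronglyMeasurable_weak_integrand hL.1 hM.1 hC'.continuous.aestronglyMeasurable
      (measurable_fderiv ℝ _).aestronglyMeasurable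
  have hbound : IntegrableOn (fun x => ‖L x‖ * D + (k * n) * (‖M x‖ * C')) Ω :=
    (hL.norm.mul_const _).add ((hM.norm.mul_const _).const_mul _)
  have hint := Integrable.mono' hbound hmeas (Eventually.of_forall fun x => by
    refine (norm_add_le _ _).trans (add_le_add ?_ ?_)
    · refine ((L x).le_opNorm _).trans ?_
      gcongr
      exact hD x
    · refine (abs_frob_le _ _).trans ?_
      gcongr
      exact norm_fderiv_le_of_lipschitz ℝ hC')
  exact hint.congr h2

/-- For a stationary configuration of a scale-free energy, the scaling field has divergence `n W`
in the sense of distributions. -/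
theorem IsStationary.hasWeakDiv_scalingField (hst : IsStationary W Ω y) (hΩ : IsOpen Ω)
    (hb : Bornology.IsBounded Ω) (h𝒰 : IsOpen 𝒰) (hW : ContDiffOn ℝ 1 W 𝒰)
    (hs : IsScaleFree W 𝒰) (hy : IsLipschitzConfig Ω y) (hr : HasRangeIn Ω y 𝒰) :
    HasWeakDiv Ω (fun x => scalingField W (jet Ω y x)) fun x => n * W (jet Ω y x) := by
  intro K ζ hζ hζc hζΩ
  obtain ⟨C, u, hu, heq⟩ := hy.exists_extension
  have hX := integrableOn_comp_jet hΩ hb hy hr (continuousOn_dX h𝒰 hW)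
  have hY := integrableOn_comp_jet hΩ hb hy hr (continuousOn_dY h𝒰 hW)
  have hP := integrableOn_comp_jet hΩ hb hy hr (continuousOn_piola h𝒰 hW)
  have hE := integrableOn_comp_jet hΩ hb hy hr (continuousOn_eshelby h𝒰 hW)
  -- The infinitesimal scaling `(x, y)` as a variation: `ζ x` enters the equation for `P*` and `ζ y`
  -- the equation for `P`.
  obtain ⟨i1, e1⟩ := weak_equation_smul hΩ hX hE hst.2 LipschitzWith.id hζ hζc hζΩ
  obtain ⟨i2, e2⟩ := weak_equation_smul hΩ hY hP hst.1 hu hζ hζc hζΩ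
  have hsum := integral_add i1 i2
  rw [e1, e2, add_zero] at hsum
  rw [← hsum]
  obtain ⟨S, -, hS𝒰, hae⟩ := hr
  refine integral_congr_ae ?_
  filter_upwards [hae, ae_restrict_mem hΩ.measurableSet] with x hx hxΩ
  have hu1 : u x = y x := (heq (subset_closure hxΩ)).symm
  have hu2 : fderiv ℝ u x = defGrad Ω y x := (defGrad_eq_fderiv_of_eqOn hΩ heq hxΩ).symm
  have he := hs.euler h𝒰 hW (hS𝒰 hx)
  have hf := frob_eshelby_id W (jet Ω y x)
  rw [hu1, hu2, fderiv_id, id_eq, scalingField, map_add]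
  simp only [jet] at he hf ⊢
  linear_combination (-ζ x) * hf - ζ x * he

/-- The energy of a stationary configuration of a scale-free density is a boundary integral. -/
theorem IsStationary.energy_eq_flux (hst : IsStationary W Ω y) (hΩ : IsOpen Ω)
    (hb : Bornology.IsBounded Ω) (hL : HasLipschitzBoundary Ω) (h𝒰 : IsOpen 𝒰)
    (hW : ContDiffOn ℝ 1 W 𝒰) (hs : IsScaleFree W 𝒰) (hy : IsLipschitzConfig Ω y)
    (hr : HasRangeIn Ω y 𝒰) (hC2 : IsC2NearBoundary Ω y) :
    IntegrableOn (fun x => ⟪scalingField W (jet Ω y x), outerNormal Ω x⟫) (frontier Ω)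
      (surfaceMeasure n) ∧
    n * ∫ x in Ω, W (jet Ω y x) =
      ∫ x in frontier Ω, ⟪scalingField W (jet Ω y x), outerNormal Ω x⟫ ∂(surfaceMeasure n) := by
  have hB := integrableOn_comp_jet hΩ hb hy hr (continuousOn_scalingField h𝒰 hW)
  have hg := (integrableOn_comp_jet hΩ hb hy hr hW.continuousOn).const_mul (n : ℝ)
  have hdiv := hst.hasWeakDiv_scalingField hΩ hb h𝒰 hW hs hy hr
  obtain ⟨N, hN, hfN, hyN⟩ := hC2
  obtain ⟨S, hS, hS𝒰, hae⟩ := hr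
  have hj := continuousOn_jet hL hΩ hN hyN
  have hBc : ContinuousOn (fun x => scalingField W (jet Ω y x)) (closure Ω ∩ N) :=
    (continuousOn_scalingField h𝒰 hW).comp hj
      fun x hx => hS𝒰 (jet_mem_of_ae_mem hΩ hN hS.isClosed hae hj hx)
  constructor
  · refine hL.integrableOn_frontier hΩ hb
      (f := fun q => ⟪scalingField W (jet Ω y q.1), q.2⟫) ?_
    have h1 : ContinuousOn (fun q : V n × V n => scalingField W (jet Ω y q.1))
        (frontier Ω ×ˢ univ) :=
      hBc.comp continuousOn_fst fun q hq => ⟨frontier_subset_closure hq.1, hfN hq.1⟩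
    exact h1.inner (𝕜 := ℝ) continuousOn_snd
  · rw [← integral_const_mul]
    exact hL.integral_div_eq_flux hΩ hb hB hg hN hfN hBc hdiv

end Scaling

/-! ### Jump of the deformation gradient along the boundary -/

section Boundary

variable {n m : ℕ} {Ω : Set (V n)}

/-- If `u` vanishes on `∂Ω`, its gradient has rank one on the boundary, in normal direction. -/
theorem IsLocalEpigraph.rank_one {N : Set (V n)} {e : V n} {γ : (ℝ ∙ e)ᗮ → ℝ} {K : ℝ≥0}
    (h : IsLocalEpigraph Ω N e γ K) (hΩ : IsOpen Ω) {v : (ℝ ∙ e)ᗮ} (hv : graphMap e γ v ∈ N)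
    (hd : DifferentiableAt ℝ γ v) {u : V n → V m} (hu0 : ∀ x ∈ frontier Ω, u x = 0) {D : Mat m n}
    (hu : HasFDerivWithinAt u D (closure Ω) (graphMap e γ v)) (w : V n) :
    D w = ⟪w, graphNormal e γ v⟫ • D (graphNormal e γ v) := by
  set ℓ := fderiv ℝ γ v
  have hG : HasFDerivAt (graphMap e γ) (graphLin e ℓ) v :=
    (ℝ ∙ e)ᗮ.subtypeL.hasFDerivAt.add (hd.hasFDerivAt.smul_const e)
  have hev : ∀ᶠ z in 𝓝 v, graphMap e γ z ∈ frontier Ω := by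
    filter_upwards [hG.continuousAt.eventually (h.isOpen.mem_nhds hv)] with z hz
    exact h.graphMap_mem_frontier hΩ hz
  have hcomp : HasFDerivAt (u ∘ graphMap e γ) (D.comp (graphLin e ℓ)) v := by
    have h1 := hu.comp_of_tendsto v hG.hasFDerivWithinAt (s := univ) (by
      rw [nhdsWithin_univ]
      refine tendsto_nhdsWithin_iff.2 ⟨hG.continuousAt, ?_⟩
      filter_upwards [hev] with z hz using frontier_subset_closure hz)
    rwa [hasFDerivWithinAt_univ] at h1
  -- `u` vanishes identically along the graph, so `D` annihilates the tangent space.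
  have hzero : D.comp (graphLin e ℓ) = 0 := by
    refine hcomp.unique ((hasFDerivAt_const (0 : V m) v).congr_of_eventuallyEq ?_)
    filter_upwards [hev] with z hz using hu0 _ hz
  -- Modulo tangent vectors every `w` is a multiple of `e`. Taking `w` to be the normal expresses `D
  -- e` through `D ν` and removes the area factor.
  have hcoef (w : V n) : D w = (-(areaFactor ℓ * ⟪w, graphNormal e γ v⟫)) • D e := by
    have h1 := congrArg (fun L : (ℝ ∙ e)ᗮ →L[ℝ] V m =>
      L ((ℝ ∙ e)ᗮ.orthogonalProjectionOnto w)) hzero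
    simp only [ContinuousLinearMap.comp_apply, graphLin_apply, map_add, map_smul,
      zero_apply] at h1
    rw [areaFactor_mul_inner_graphNormal]
    conv_lhs => rw [← orthogonalProjectionOnto_add_inner_smul h.norm_eq w, map_add, map_smul]
    rw [eq_neg_of_add_eq_zero_left h1]
    module
  rw [hcoef (graphNormal e γ v), hcoef w, real_inner_self_eq_norm_sq,
    norm_graphNormal h.norm_eq, smul_smul]
  congr 1
  ring

/-- The deformation gradients of two configurations with the same boundary values differ, almost
everywhere on the boundary, by a rank one matrix in normal direction. -/
theorem HasLipschitzBoundary.ae_rank_one (hL : HasLipschitzBoundary Ω) (hΩ : IsOpen Ω)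
    {y₁ y₂ : V n → V m} (h₁ : IsC2NearBoundary Ω y₁) (h₂ : IsC2NearBoundary Ω y₂)
    (heq : ∀ x ∈ frontier Ω, y₁ x = y₂ x) :
    ∀ᵐ x ∂((surfaceMeasure n).restrict (frontier Ω)), ∀ w,
      (defGrad Ω y₂ x - defGrad Ω y₁ x) w =
        ⟪w, outerNormal Ω x⟫ • (defGrad Ω y₂ x - defGrad Ω y₁ x) (outerNormal Ω x) := by
  set Good : V n → Prop := fun x => ∀ w, (defGrad Ω y₂ x - defGrad Ω y₁ x) w =
    ⟪w, outerNormal Ω x⟫ • (defGrad Ω y₂ x - defGrad Ω y₁ x) (outerNormal Ω x)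
  obtain ⟨N₁, hN₁, hf₁, hc₁⟩ := h₁
  obtain ⟨N₂, hN₂, hf₂, hc₂⟩ := h₂
  rw [ae_restrict_iff'₀ isClosed_frontier.measurableSet.nullMeasurableSet, ae_iff]
  refine measure_null_of_locally_null _ fun p hp => ?_
  have hpf : p ∈ frontier Ω := by
    by_contra hcon; exact hp fun h => absurd h hcon
  obtain ⟨e, γ, K, N, hpN, h⟩ := hL.exists_isLocalEpigraph hpf
  refine ⟨{x | ¬(x ∈ frontier Ω → Good x)} ∩ N, inter_mem self_mem_nhdsWithin
    (mem_nhdsWithin_of_mem_nhds (h.isOpen.mem_nhds hpN)), ?_⟩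
  have hloc : ∀ᵐ x ∂((surfaceMeasure n).restrict (frontier Ω ∩ N)), Good x := by
    rw [h.surfaceMeasure_restrict_frontier_inter hΩ h.isOpen.measurableSet subset_rfl,
      (measurableEmbedding_graphMap h.lip.continuous).ae_map_iff]
    have hG := (continuous_graphMap (e := e) h.lip.continuous).measurable
    rw [ae_restrict_iff' (hG h.isOpen.measurableSet)]
    refine (withDensity_absolutelyContinuous volume
      fun v => ENNReal.ofReal (areaFactor (fderiv ℝ γ v))).ae_le ?_
    filter_upwards [h.ae_outerNormal_eq, h.lip.ae_differentiableAt] with v hv hd hvN w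
    have hfr := h.graphMap_mem_frontier hΩ hvN
    have hcl := frontier_subset_closure hfr
    rw [hv hvN]
    exact h.rank_one hΩ hvN hd (u := fun x => y₂ x - y₁ x)
      (fun x hx => by rw [heq x hx, sub_self])
      ((hasFDerivWithinAt_defGrad hN₂ hc₂ hcl (hf₂ hfr)).sub
        (hasFDerivWithinAt_defGrad hN₁ hc₁ hcl (hf₁ hfr))) w
  rw [ae_restrict_iff'₀ (isClosed_frontier.measurableSet.inter
    h.isOpen.measurableSet).nullMeasurableSet, ae_iff] at hloc
  refine measure_mono_null (fun x hx => ?_) hloc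
  show ¬(x ∈ frontier Ω ∩ N → Good x)
  exact fun hcon => hx.1 fun hxf => hcon ⟨hxf, hx.2⟩

/-- The boundary density is the difference of the fluxes of the scaling fields. -/
theorem flux_sub_flux_eq_boundaryDensity {W : Density n m} {y₀ y₁ y₂ : V n → V m} {x : V n}
    (h₁ : y₁ x = y₀ x) (h₂ : y₂ x = y₀ x)
    (hr : ∀ w, (defGrad Ω y₂ x - defGrad Ω y₁ x) w =
        ⟪w, outerNormal Ω x⟫ • (defGrad Ω y₂ x - defGrad Ω y₁ x) (outerNormal Ω x)) :
    ⟪scalingField W (jet Ω y₂ x), outerNormal Ω x⟫ -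
      ⟪scalingField W (jet Ω y₁ x), outerNormal Ω x⟫ = boundaryDensity W Ω y₁ y₂ y₀ x := by
  have hj₁ : jet Ω y₁ x = (x, y₀ x, defGrad Ω y₁ x) := by rw [jet, h₁]
  have hj₂ : jet Ω y₂ x = (x, y₀ x, defGrad Ω y₂ x) := by rw [jet, h₂]
  have hfr := frob_of_rank_one (A := piola W (x, y₀ x, defGrad Ω y₁ x)) hr
  -- Rank one is used twice: with `w = x` it exchanges `F₁ x` for `F₂ x` in the flux of `y₁`, and
  -- the price `(x · n) P₁ n · (F₂ - F₁) n` is exactly the linear term of the excess given by `hfr`.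
  have hx := congrArg (fun z => ⟪piola W (x, y₀ x, defGrad Ω y₁ x) (outerNormal Ω x), z⟫) (hr x)
  simp only [inner_smul_right, sub_apply, inner_sub_right] at hx hfr
  rw [boundaryDensity, excess, inner_scalingField, inner_scalingField, hj₁, hj₂, hfr]
  simp only [sub_apply, inner_sub_left, inner_sub_right]
  linear_combination -hx

end Boundary

end Elasticity

end

/-! ### The energy difference as a boundary integral -/

theorem mainTheorem4 {n m : ℕ} (hn : 0 < n)
    (Ω : Set (Elasticity.V n)) (hΩ_open : IsOpen Ω) (hΩ_bdd : Bornology.IsBounded Ω)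
    (hΩ_lip : Elasticity.HasLipschitzBoundary Ω)
    (𝒰 : Set (Elasticity.V n × Elasticity.V m × Elasticity.Mat m n)) (h𝒰 : IsOpen 𝒰)
    (W : Elasticity.Density n m) (hW : ContDiffOn ℝ 1 W 𝒰)
    (hW_scale : Elasticity.IsScaleFree W 𝒰)
    (y₀ y₁ y₂ : Elasticity.V n → Elasticity.V m)
    (hy₁_lip : Elasticity.IsLipschitzConfig Ω y₁) (hy₂_lip : Elasticity.IsLipschitzConfig Ω y₂)
    (hy₁_range : Elasticity.HasRangeIn Ω y₁ 𝒰) (hy₂_range : Elasticity.HasRangeIn Ω y₂ 𝒰)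
    (hy₁_stat : Elasticity.IsStationary W Ω y₁) (hy₂_stat : Elasticity.IsStationary W Ω y₂)
    (hy₁_C2 : Elasticity.IsC2NearBoundary Ω y₁) (hy₂_C2 : Elasticity.IsC2NearBoundary Ω y₂)
    (hy₁_bdry : ∀ x ∈ frontier Ω, y₁ x = y₀ x) (hy₂_bdry : ∀ x ∈ frontier Ω, y₂ x = y₀ x) :
    IntegrableOn (fun x => W (Elasticity.jet Ω y₁ x)) Ω volume ∧
    IntegrableOn (fun x => W (Elasticity.jet Ω y₂ x)) Ω volume ∧
    IntegrableOn (Elasticity.boundaryDensity W Ω y₁ y₂ y₀) (frontier Ω)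
      (Elasticity.surfaceMeasure n) ∧
    ∫ x in Ω, (W (Elasticity.jet Ω y₂ x) - W (Elasticity.jet Ω y₁ x)) =
      (1 / (n : ℝ)) * ∫ x in frontier Ω, Elasticity.boundaryDensity W Ω y₁ y₂ y₀ x
        ∂(Elasticity.surfaceMeasure n) := by
  have hI₁ := Elasticity.integrableOn_comp_jet hΩ_open hΩ_bdd hy₁_lip hy₁_range hW.continuousOn
  have hI₂ := Elasticity.integrableOn_comp_jet hΩ_open hΩ_bdd hy₂_lip hy₂_range hW.continuousOn
  obtain ⟨hS₁, hE₁⟩ := hy₁_stat.energy_eq_flux hΩ_open hΩ_bdd hΩ_lip h𝒰 hW hW_scale hy₁_lip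
    hy₁_range hy₁_C2
  obtain ⟨hS₂, hE₂⟩ := hy₂_stat.energy_eq_flux hΩ_open hΩ_bdd hΩ_lip h𝒰 hW hW_scale hy₂_lip
    hy₂_range hy₂_C2
  have hae : ∀ᵐ x ∂((Elasticity.surfaceMeasure n).restrict (frontier Ω)),
      ⟪Elasticity.scalingField W (Elasticity.jet Ω y₂ x), Elasticity.outerNormal Ω x⟫ -
        ⟪Elasticity.scalingField W (Elasticity.jet Ω y₁ x), Elasticity.outerNormal Ω x⟫ =
      Elasticity.boundaryDensity W Ω y₁ y₂ y₀ x := by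
    filter_upwards [ae_restrict_mem isClosed_frontier.measurableSet,
      hΩ_lip.ae_rank_one hΩ_open hy₁_C2 hy₂_C2
        fun x hx => (hy₁_bdry x hx).trans (hy₂_bdry x hx).symm] with x hx hr
    exact Elasticity.flux_sub_flux_eq_boundaryDensity (hy₁_bdry x hx) (hy₂_bdry x hx) hr
  refine ⟨hI₁, hI₂, (hS₂.sub hS₁).congr hae, ?_⟩
  have hn' : (n : ℝ) ≠ 0 := by positivity
  rw [← integral_congr_ae hae, integral_sub hS₂ hS₁, ← hE₁, ← hE₂, integral_sub hI₂ hI₁]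
  field_simp
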